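/- Let $\mathbb{F}_q$ be a finite field with $q$ elements, let $n,m\ge 0$, and let $\mathcal{F}$ be a field of rational functions in $n+m$ variables over $\mathbb{F}_q$. A seed $(\mathbf{x},\tilde B)$ in $\mathcal F$ consists of algebraically independent elements $x_1,\dots,x_{n+m}$ generating $\mathcal F$ as a field over $\mathbb{F}_q$ and an integer $(n+m)\times n$ matrix $\tilde B$ whose top $n\times n$ part is skew-symmetric. Its mutation at $k\in\{1,\dots,n\}$ replaces $x_k$ by $x_k'=x_k^{-1}\bigl(\prod_i x_i^{[\tilde B_{ik}]_+}+\prod_i x_i^{[-\tilde B_{ik}]_+}\bigr)$, keeps the other $x_i$, and replaces $\tilde B$ by $\tilde B'$ with $\tilde B'_{ij}=-\tilde B_{ij}$ if $i=k$ or $j=k$, and $\tilde B'_{ij}=\tilde B_{ij}+[\tilde B_{ik}]_+[\tilde B_{kj}]_+-[\tilde B_{ik}]_-[\tilde B_{kj}]_-$ otherwise, where $[x]_+=\max(x,0)$ and $[x]_-=\min(x,0)$. The cluster algebra $A$ of a seed is the $\mathbb{F}_q$-subalgebra of $\mathcal F$ generated by the entries of the tuples of all seeds obtained from it by finite sequences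 of mutations, together with $x_{n+1}^{-1},\dots,x_{n+m}^{-1}$; the cluster variety is $\mathcal{A}=\operatorname{Spec}A$, and $\mathcal{A}(\mathbb{F}_q)=\operatorname{Hom}_{\mathbb{F}_q\text{-alg}}(A,\mathbb{F}_q)$. Let $\mathcal{A}$ be the cluster variety of a seed whose matrix has full rank $n$ (over $\mathbb{Q}$), and suppose $\mathcal{A}$ is acyclic, i.e. some seed obtained from the given one by mutations has a matrix $\tilde B$ whose quiver $\vec\Gamma$ (vertices $1,\dots,n$, an edge $i\to j$ whenever $\tilde B_{ij}>0$) has no oriented cycles. Fix such an acyclic seed, with matrix $\tilde B$. Let $\mathcal{I}_k$ be the set of $k$-element independent sets (anticliques) of the underlying undirected graph of $\vec\Gamma$, let $\mathcal{I}=\bigcup_k\mathcal{I}_k$, and for $I\in\mathcal{I}$ put $$X^*(I)=(\tilde B_I\mathbb{Q}^I\cap\mathbb{Z}^{n+m})/\tilde B_I\mathbb{Z}^I,$$ where $\tilde B_I$ consists of the columns of $\tilde B$ indexed by $I$. Let $N$ be the minimal positive integer such that $g^N=1$ for all $g\in X^*(I)$ and all $I\in\mathcal{I}$, and suppose that $q\equiv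 1 \bmod 2N$. Then $$\#\mathcal{A}(\mathbb{F}_q)=\sum_{k=0}^{n} q^k(q-1)^{n+m-2k}\sum_{I\in\mathcal{I}_k}|X^*(I)|.$$ (If $\mathcal{I}_k\neq\emptyset$ then $2k\le n+m$; terms with $\mathcal{I}_k=\emptyset$ are $0$.) -/

import Mathlib

namespace ClusterVariety

/-- Integer matrices of size `(n + m) × n`: the rows `Sum.inl i` are the mutable ones (the first
`n` rows), the rows `Sum.inr j` are the frozen ones (the last `m` rows). -/
abbrev ExtMatrix (n m : ℕ) : Type := Matrix (Fin n ⊕ Fin m) (Fin n) ℤ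

namespace ExtMatrix

variable {n m : ℕ}

/-- `B` is an extended exchange matrix: its top `n × n` part is skew-symmetric. -/
def IsExchange (B : ExtMatrix n m) : Prop :=
  ∀ i j : Fin n, B (Sum.inl i) j = -B (Sum.inl j) i

/-- Full rank: the rank (over `ℚ`) equals the number `n` of columns. -/
def FullRank (B : ExtMatrix n m) : Prop :=
  (B.map (Int.cast : ℤ → ℚ)).rank = n

/-- Matrix mutation in direction `k`. -/
def mutate (B : ExtMatrix n m) (k : Fin n) : ExtMatrix n m :=
  Matrix.of fun i j =>
    if i = Sum.inl k ∨ j = k then -B i j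
    else B i j + max (B i k) 0 * max (B (Sum.inl k) j) 0
      - min (B i k) 0 * min (B (Sum.inl k) j) 0

/-- The edge relation of the quiver: there is an edge `i → j` whenever `B i j > 0`. -/
def Edge (B : ExtMatrix n m) (i j : Fin n) : Prop := 0 < B (Sum.inl i) j

/-- The quiver has no oriented cycle. -/
def IsAcyclic (B : ExtMatrix n m) : Prop :=
  ∀ i : Fin n, ¬ Relation.TransGen B.Edge i i

/-- The underlying undirected graph of the quiver. -/
def graph (B : ExtMatrix n m) : SimpleGraph (Fin n) := SimpleGraph.fromRel B.Edge

/-- The anticliques (independent sets) with `k` elements. -/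
noncomputable def anticliques (B : ExtMatrix n m) (k : ℕ) : Finset (Finset (Fin n)) :=
  open Classical in Finset.univ.filter fun I => B.graph.IsNIndepSet k I

/-- The submatrix consisting of the columns indexed by `I`. -/
def cols (B : ExtMatrix n m) (I : Finset (Fin n)) : Matrix (Fin n ⊕ Fin m) I ℤ :=
  B.submatrix id Subtype.val

/-- The lattice `B_I ℤ^I` in `ℤ^(n+m)`. -/
def colLattice (B : ExtMatrix n m) (I : Finset (Fin n)) : AddSubgroup (Fin n ⊕ Fin m → ℤ) :=
  (B.cols I).mulVecLin.toAddMonoidHom.range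

/-- The lattice `B_I ℚ^I ∩ ℤ^(n+m)` of integer vectors in the rational column span. -/
def satLattice (B : ExtMatrix n m) (I : Finset (Fin n)) : AddSubgroup (Fin n ⊕ Fin m → ℤ) :=
  ((B.cols I).map (Int.cast : ℤ → ℚ)).mulVecLin.toAddMonoidHom.range.comap
    ((Int.castAddHom ℚ).compLeft (Fin n ⊕ Fin m))

/-- The group `X*(I) = (B_I ℚ^I ∩ ℤ^(n+m)) / B_I ℤ^I`. -/
abbrev charGroup (B : ExtMatrix n m) (I : Finset (Fin n)) : Type :=
  B.satLattice I ⧸ (B.colLattice I).addSubgroupOf (B.satLattice I)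

end ExtMatrix

/-- The data of a seed in a field `𝓕`: the tuple `x`, with mutable entries `x (Sum.inl i)` and
frozen entries `x (Sum.inr j)`, and an `(n + m) × n` matrix. -/
structure SeedData (𝓕 : Type*) (n m : ℕ) where
  x : Fin n ⊕ Fin m → 𝓕
  B : ExtMatrix n m

namespace SeedData

variable {𝓕 : Type*} [Field 𝓕] {n m : ℕ}

/-- `s` is a seed in `𝓕` over the ground field `K`: the tuple `x` is a free generating set of the
field extension `𝓕` of `K` (so `𝓕` is a field of rational functions in `n + m` variables), and the
matrix is an extended exchange matrix. -/
structure IsSeed (K : Type*) [Field K] [Algebra K 𝓕] (s : SeedData 𝓕 n m) : Prop where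
  algebraicIndependent : AlgebraicIndependent K s.x
  generates : IntermediateField.adjoin K (Set.range s.x) = ⊤
  isExchange : s.B.IsExchange

/-- Seed mutation in direction `k`; the exponents `(B i k).toNat` and `(-B i k).toNat` are
`max (B i k) 0` and `max (-B i k) 0`. -/
noncomputable def mutate (s : SeedData 𝓕 n m) (k : Fin n) : SeedData 𝓕 n m where
  x := Function.update s.x (Sum.inl k)
    ((∏ i, s.x i ^ (s.B i k).toNat + ∏ i, s.x i ^ (-s.B i k).toNat) / s.x (Sum.inl k))
  B := s.B.mutate k

/-- `t` is obtained from `s` by a finite sequence of mutations. -/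
def Reaches (s t : SeedData 𝓕 n m) : Prop :=
  Relation.ReflTransGen (fun a b : SeedData 𝓕 n m => ∃ k, b = a.mutate k) s t

/-- The cluster algebra over `K`: the subalgebra of `𝓕` generated by all the cluster variables of
all seeds obtained from `s` by mutations, and by the inverses of the frozen variables. -/
def clusterAlgebra (K : Type*) [Field K] [Algebra K 𝓕] (s : SeedData 𝓕 n m) : Subalgebra K 𝓕 :=
  Algebra.adjoin K
    ({z | ∃ t, s.Reaches t ∧ ∃ i, z = t.x i} ∪ Set.range fun j : Fin m => (s.x (Sum.inr j))⁻¹)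

/-- The `K`-points of the cluster variety `Spec A`, where `A` is the cluster algebra over `K`. -/
abbrev points (K : Type*) [Field K] [Algebra K 𝓕] (s : SeedData 𝓕 n m) : Type _ :=
  s.clusterAlgebra K →ₐ[K] K

end SeedData

end ClusterVariety

/-!
The count rests on an identification of the `K`-points of the cluster variety with the solutions
of the exchange relations of the acyclic seed `t`, followed by a stratification of the solutions.

*The Laurent phenomenon.* The upper bound of a seed is the intersection of its Laurent ring with
those of the neighbouring seeds. For seeds of full rank it is invariant under mutation. This
concerns two directions at a time. If they are joined by an edge, the denominators occurring are
comaximal (`mem_laurent_of_noncommuting`). If they are not, the two mutations commute, and one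
needs that the two exchange binomials are relatively prime. Up to monomials these are `1 + y ^ u`
and `1 + y ^ w` with `u` and `w` linearly independent, and a substitution `y i ↦ y i * t ^ ℓ i` with
a linear form `ℓ` that kills `u` but not `w` separates them (`relPrime_binomials`). The claim is
then obtained by comparing Laurent expansions (`mem_pair_pair_of_relPrime`). Since full rank is
preserved by mutation, the cluster algebra is contained in the Laurent ring of every seed
(`IsRegular.clusterAlgebra_le_laurentRing`).

*Points are solutions.* A point of the cluster variety gives values of `t.x i` and of `t.x' l`,
subject to the exchange relations `x l * x' l = exchange l`. If the quiver of `t` is acyclic, then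
the vertices at which a solution vanishes form an independent set `I`
(`IsAcyclic.eq_zero_of_solution`). Mutations at the vertices of `I` commute, and intersecting the
Laurent rings of the seeds they lead to shows that the cluster algebra lies in the ring generated by
`x l`, `x' l` for `l ∈ I` and by `x i`, `(x i)⁻¹` for the other `i`
(`IsRegular.clusterAlgebra_le_iSup_piece`). So a point with vanishing set `I` is determined by its
solution. Conversely, given a solution with vanishing set `I`, the seed mutated at all of `I` has
the cluster consisting of the `x' l` for `l ∈ I` and the other `x i`. Sending the `x' l` to
indeterminates and the other `x i` to their nonzero values extends to the Laurent ring of this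
cluster; it sends `x l` to `0` for `l ∈ I`, hence the cluster algebra to polynomials, in which the
indeterminates may be specialized to arbitrary values, zero included
(`exists_algHom_mvPolynomial`). Thus points and solutions correspond bijectively
(`SeedData.card_points`).

*Counting.* On the stratum of the solutions whose vanishing set is the independent set `I`, the
variables `x' l` with `l ∈ I` are free, the remaining `x i` are units at which the exchange
binomials of `I` vanish, and the other `x' l` are determined. The exchange binomial in direction
`l` vanishes at a point `χ` of the torus if and only if `∏ i, χ i ^ B i l = -1`. These equations
prescribe the restriction of the character `χ` of `ℤ^(n+m)` to the lattice spanned by the columns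
of `I`. By the Smith normal form and by the existence of the required roots of `-1`, which the
congruence on `q` provides, they have `(q - 1)^(n+m-#I) * |X*(I)|` solutions (`card_characters`).
Since the coordinates of `χ` indexed by `I` do not occur in them, the stratum has
`q^(#I) * (q - 1)^(n+m-2*#I) * |X*(I)|` points (`card_stratum`).
-/

/-! ### Laurent expansions in one variable -/

namespace ClusterVariety

section OneVariable

variable {K 𝓕 : Type*} [Field K] [Field 𝓕] [Algebra K 𝓕]

/-- The algebra `R[x, y]` is the `R`-span of any family in it that contains `1` and whose span is
stable under multiplication by `x` and by `y`. -/
theorem mem_sup_adjoin_pair_iff_mem_span (R : Subalgebra K 𝓕) {x y : 𝓕} {e : ℤ → 𝓕}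
    (h0 : e 0 = 1) (hx : ∀ v, x * e v ∈ Submodule.span R (Set.range e))
    (hy : ∀ v, y * e v ∈ Submodule.span R (Set.range e))
    (he : ∀ v, e v ∈ R ⊔ Algebra.adjoin K {x, y}) {z : 𝓕} :
    z ∈ R ⊔ Algebra.adjoin K {x, y} ↔ z ∈ Submodule.span R (Set.range e) := by
  have hR : R ⊔ Algebra.adjoin K {x, y} = Algebra.adjoin K ((R : Set 𝓕) ∪ {x, y}) := by
    rw [Algebra.adjoin_union, Algebra.adjoin_eq]
  have gen : ∀ a : 𝓕, (∀ v, a * e v ∈ Submodule.span R (Set.range e)) →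
      ∀ w ∈ Submodule.span R (Set.range e), a * w ∈ Submodule.span R (Set.range e) := by
    intro a ha w hw
    induction hw using Submodule.span_induction with
    | mem w hw => obtain ⟨v, rfl⟩ := hw; exact ha v
    | zero => simp
    | add u v _ _ hu hv => rw [mul_add]; exact add_mem hu hv
    | smul r u _ hu =>
      rw [mul_smul_comm]
      exact Submodule.smul_mem _ r hu
  constructor
  · intro hz
    rw [hR] at hz
    -- right multiplication by `z` preserves the span, and the span contains `1`
    have key : ∀ w ∈ Submodule.span R (Set.range e), z * w ∈ Submodule.span R (Set.range e) := by
      induction hz using Algebra.adjoin_induction with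
      | mem u hu =>
        rcases hu with hu | hu | hu
        · intro w hw
          exact Submodule.smul_mem _ (⟨u, hu⟩ : R) hw
        · subst hu; exact gen _ hx
        · rw [Set.mem_singleton_iff] at hu; subst hu; exact gen _ hy
      | algebraMap r =>
        intro w hw
        exact Submodule.smul_mem _ (⟨_, R.algebraMap_mem r⟩ : R) hw
      | add u v _ _ hu hv =>
        intro w hw; rw [add_mul]; exact add_mem (hu w hw) (hv w hw)
      | mul u v _ _ hu hv =>
        intro w hw; rw [mul_assoc]; exact hu _ (hv w hw)
    have h1 : (1 : 𝓕) ∈ Submodule.span R (Set.range e) := h0 ▸ Submodule.subset_span ⟨0, rfl⟩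
    simpa using key 1 h1
  · intro hz
    induction hz using Submodule.span_induction with
    | mem w hw => obtain ⟨v, rfl⟩ := hw; exact he v
    | zero => exact zero_mem _
    | add u v _ _ hu hv => exact add_mem hu hv
    | smul r u _ hu => exact mul_mem ((le_sup_left : R ≤ _) r.2) hu

theorem left_mem_adjoin_pair (x y : 𝓕) : x ∈ Algebra.adjoin K {x, y} :=
  Algebra.subset_adjoin (by simp)

theorem right_mem_adjoin_pair (x y : 𝓕) : y ∈ Algebra.adjoin K {x, y} :=
  Algebra.subset_adjoin (by simp)

theorem zpow_mem_adjoin_pair (x : 𝓕) (v : ℤ) : x ^ v ∈ Algebra.adjoin K {x, x⁻¹} := by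
  obtain ⟨m, rfl | rfl⟩ := v.eq_nat_or_neg
  · simpa using pow_mem (left_mem_adjoin_pair x x⁻¹) m
  · simpa using pow_mem (right_mem_adjoin_pair x x⁻¹) m

theorem mem_sup_laurent_iff_mem_span (R : Subalgebra K 𝓕) {x : 𝓕} (hx : x ≠ 0) {z : 𝓕} :
    z ∈ R ⊔ Algebra.adjoin K {x, x⁻¹} ↔ z ∈ Submodule.span R (Set.range fun v : ℤ => x ^ v) := by
  refine mem_sup_adjoin_pair_iff_mem_span R (by simp) (fun v => ?_) (fun v => ?_) (fun v => ?_)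
  · exact Submodule.subset_span ⟨v + 1, by simp [zpow_add₀ hx, mul_comm]⟩
  · exact Submodule.subset_span ⟨v - 1, by simp [zpow_sub₀ hx, mul_comm, div_eq_mul_inv]⟩
  · exact (le_sup_right : _ ≤ R ⊔ Algebra.adjoin K {x, x⁻¹}) (zpow_mem_adjoin_pair x v)

theorem mem_sup_pair_iff_mem_span (R : Subalgebra K 𝓕) {x y P : 𝓕} (hx : x ≠ 0) (hP : P ∈ R)
    (hxy : x * y = P) {z : 𝓕} :
    z ∈ R ⊔ Algebra.adjoin K {x, y} ↔
      z ∈ Submodule.span R (Set.range fun v : ℤ => P ^ (-v).toNat * x ^ v) := by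
  have hy : y = P * x⁻¹ := by rw [← hxy]; field_simp
  refine mem_sup_adjoin_pair_iff_mem_span R (by simp) (fun v => ?_) (fun v => ?_) (fun v => ?_)
  · rcases lt_or_ge v 0 with hv | hv
    · have h1 : (-v).toNat = (-(v + 1)).toNat + 1 := by omega
      have h2 : x * (P ^ (-v).toNat * x ^ v) =
          (⟨P, hP⟩ : R) • (P ^ (-(v + 1)).toNat * x ^ (v + 1)) := by
        change _ = P * _
        rw [h1, pow_succ, zpow_add₀ hx, zpow_one]; ring
      rw [h2]
      exact Submodule.smul_mem _ _ (Submodule.subset_span ⟨v + 1, rfl⟩)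
    · refine Submodule.subset_span ⟨v + 1, ?_⟩
      have h1 : (-v).toNat = 0 := by omega
      have h2 : (-(v + 1)).toNat = 0 := by omega
      simp only [h1, h2, zpow_add₀ hx, zpow_one]; ring
  · rcases lt_or_ge 0 v with hv | hv
    · have h1 : (-v).toNat = 0 := by omega
      have h2 : (-(v - 1)).toNat = 0 := by omega
      have h3 : y * (P ^ (-v).toNat * x ^ v) =
          (⟨P, hP⟩ : R) • (P ^ (-(v - 1)).toNat * x ^ (v - 1)) := by
        change _ = P * _
        rw [h1, h2, hy, zpow_sub₀ hx, zpow_one]; ring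
      rw [h3]
      exact Submodule.smul_mem _ _ (Submodule.subset_span ⟨v - 1, rfl⟩)
    · refine Submodule.subset_span ⟨v - 1, ?_⟩
      have h1 : (-(v - 1)).toNat = (-v).toNat + 1 := by omega
      simp only [h1, hy, zpow_sub₀ hx, zpow_one, pow_succ]; ring
  · refine (le_sup_right : _ ≤ R ⊔ Algebra.adjoin K {x, y}) ?_
    rcases lt_or_ge v 0 with hv | hv
    · have : P ^ (-v).toNat * x ^ v = y ^ (-v).toNat := by
        have h : x ^ v = (x ^ (-v).toNat)⁻¹ := by
          rw [← zpow_natCast, ← zpow_neg]; congr 1; omega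
        rw [hy, mul_pow, h, inv_pow]
      rw [this]
      exact pow_mem (right_mem_adjoin_pair x y) _
    · lift v to ℕ using hv
      simpa using pow_mem (left_mem_adjoin_pair x y) v

theorem mem_sup_laurent'_iff_mem_span (R : Subalgebra K 𝓕) {x y P : 𝓕} (hx : x ≠ 0)
    (hy : y ≠ 0) (hxy : x * y = P) {z : 𝓕} :
    z ∈ R ⊔ Algebra.adjoin K {y, y⁻¹} ↔
      z ∈ Submodule.span R (Set.range fun v : ℤ => P ^ (-v) * x ^ v) := by
  rw [mem_sup_laurent_iff_mem_span R hy]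
  have : (fun v : ℤ => P ^ (-v) * x ^ v) = (fun v : ℤ => y ^ v) ∘ Neg.neg := by
    funext v
    simp only [Function.comp]
    rw [← hxy, mul_zpow, mul_right_comm, ← zpow_add₀ hx]; simp
  rw [this, neg_surjective.range_comp]

variable {E : IntermediateField K 𝓕} {x : 𝓕}

theorem ne_zero_of_transcendental (hx : Transcendental E x) : x ≠ 0 :=
  fun h => hx (h ▸ isAlgebraic_zero)

/-- A choice of coefficient functionals for expansions in integer powers of a transcendental
element `x`: an `E`-linear left inverse of `c ↦ ∑ c v * x ^ v`. -/
theorem exists_coeff (hx : Transcendental E x) :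
    ∃ ρ : 𝓕 →ₗ[E] (ℤ →₀ E), ∀ c : ℤ →₀ E,
      ρ (Finsupp.linearCombination E (fun v : ℤ => x ^ v) c) = c := by
  have hx0 : x ≠ 0 := ne_zero_of_transcendental hx
  have hpow : LinearIndependent E (fun k : ℕ => x ^ k) := by
    have h := (Polynomial.basisMonomials E).linearIndependent.map'
      (Polynomial.aeval x).toLinearMap (LinearMap.ker_eq_bot.2 (transcendental_iff_injective.1 hx))
    have h' : ⇑(Polynomial.aeval x).toLinearMap ∘ ⇑(Polynomial.basisMonomials E) =
        fun k : ℕ => x ^ k := by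
      funext k; simp
    rwa [h'] at h
  have hli : LinearIndependent E (fun v : ℤ => x ^ v) := by
    rw [linearIndependent_iff']
    intro s g hg i hi
    -- multiply the relation by a power of `x` that makes all exponents nonnegative
    obtain ⟨M, hM⟩ : ∃ M : ℕ, ∀ v ∈ s, 0 ≤ v + M := by
      obtain ⟨b, hb⟩ := s.bddBelow
      exact ⟨b.natAbs, fun v hv => by have := hb hv; omega⟩
    have h2 : ∑ v ∈ s, g v • x ^ (v + M).toNat = 0 := by
      have := congrArg (· * x ^ M) hg
      simp only [zero_mul, Finset.sum_mul] at this
      rw [← this]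
      refine Finset.sum_congr rfl fun v hv => ?_
      rw [smul_mul_assoc]
      congr 1
      rw [← zpow_natCast, Int.toNat_of_nonneg (hM v hv), zpow_add₀ hx0, zpow_natCast]
    have hinj : Set.InjOn (fun v : ℤ => (v + M).toNat) s := by
      intro a ha b hb hab
      have h1 := hM a ha
      have h2 := hM b hb
      simp only at hab
      omega
    have h3 : LinearIndepOn E (fun v : ℤ => x ^ (v + M).toNat) (s : Set ℤ) :=
      hpow.comp (fun v : s => ((v : ℤ) + M).toNat) (fun a b hab =>
        Subtype.ext (hinj a.2 b.2 hab))
    exact (linearIndepOn_finset_iff.1 h3) g h2 i hi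
  obtain ⟨ρ, hρ⟩ := LinearMap.exists_leftInverse_of_injective
    (Finsupp.linearCombination E (fun v : ℤ => x ^ v)) (LinearMap.ker_eq_bot.2 hli)
  exact ⟨ρ, fun c => LinearMap.congr_fun hρ c⟩

/-- Membership in the `R`-span of the elements `p v * x ^ v` is read off from the coefficients. -/
theorem mem_span_iff_coeff {ρ : 𝓕 →ₗ[E] (ℤ →₀ E)}
    (hρ : ∀ c : ℤ →₀ E, ρ (Finsupp.linearCombination E (fun v : ℤ => x ^ v) c) = c)
    {R : Subalgebra K 𝓕} (hR : R ≤ E.toSubalgebra) {p : ℤ → 𝓕} (hp : ∀ v, p v ∈ E) {z : 𝓕} :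
    z ∈ Submodule.span R (Set.range fun v : ℤ => p v * x ^ v) ↔
      (∀ v, ∃ r ∈ R, (ρ z v : 𝓕) = r * p v) ∧
        z = ∑ v ∈ (ρ z).support, (ρ z v : 𝓕) * x ^ v := by
  have hlc : ∀ c : ℤ →₀ E, Finsupp.linearCombination E (fun v : ℤ => x ^ v) c =
      ∑ v ∈ c.support, (c v : 𝓕) * x ^ v := fun c => rfl
  constructor
  · intro hz
    suffices h : (∀ v, ∃ r ∈ R, (ρ z v : 𝓕) = r * p v) ∧
        z = Finsupp.linearCombination E (fun v : ℤ => x ^ v) (ρ z) by rwa [hlc] at h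
    induction hz using Submodule.span_induction with
    | mem w hw =>
      obtain ⟨v, rfl⟩ := hw
      have h1 : p v * x ^ v = Finsupp.linearCombination E (fun v : ℤ => x ^ v)
          (Finsupp.single v ⟨p v, hp v⟩) := by
        rw [Finsupp.linearCombination_single]; rfl
      simp only [h1, hρ, and_true]
      refine fun u => ?_
      by_cases huv : v = u
      · subst huv; exact ⟨1, one_mem _, by simp⟩
      · exact ⟨0, zero_mem _, by simp [huv]⟩
    | zero => exact ⟨fun v => ⟨0, zero_mem _, by simp⟩, by simp⟩
    | add u w _ _ hu hw =>
      refine ⟨fun v => ?_, ?_⟩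
      · obtain ⟨r, hr, h1⟩ := hu.1 v
        obtain ⟨s, hs, h2⟩ := hw.1 v
        exact ⟨r + s, add_mem hr hs, by simp [h1, h2, add_mul]⟩
      · rw [map_add, map_add, ← hu.2, ← hw.2]
    | smul r u _ hu =>
      have hru : r • u = (⟨r, hR r.2⟩ : E) • u := rfl
      rw [hru]
      refine ⟨fun v => ?_, ?_⟩
      · obtain ⟨s, hs, h2⟩ := hu.1 v
        exact ⟨r * s, mul_mem r.2 hs, by simp [h2, mul_assoc]⟩
      · rw [map_smul, map_smul, ← hu.2]
  · rintro ⟨h1, h2⟩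
    rw [h2]
    refine Submodule.sum_mem _ fun v _ => ?_
    obtain ⟨r, hr, h3⟩ := h1 v
    rw [h3, mul_assoc]
    exact Submodule.smul_mem _ (⟨r, hr⟩ : R) (Submodule.subset_span ⟨v, rfl⟩)

section Coeff

variable {ρ : 𝓕 →ₗ[E] (ℤ →₀ E)}
  (hρ : ∀ c : ℤ →₀ E, ρ (Finsupp.linearCombination E (fun v : ℤ => x ^ v) c) = c)
  {R : Subalgebra K 𝓕} (hR : R ≤ E.toSubalgebra) {y P : 𝓕} (hx : x ≠ 0) (hP : P ∈ R)
  (hxy : x * y = P) {z : 𝓕}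

include hρ hR hx in
theorem mem_sup_laurent_iff_coeff :
    z ∈ R ⊔ Algebra.adjoin K {x, x⁻¹} ↔
      (∀ v, (ρ z v : 𝓕) ∈ R) ∧ z = ∑ v ∈ (ρ z).support, (ρ z v : 𝓕) * x ^ v := by
  rw [mem_sup_laurent_iff_mem_span R hx]
  have := mem_span_iff_coeff hρ hR (p := fun _ => 1) (fun _ => one_mem _) (z := z)
  simpa using this

include hρ hR hx hP hxy in
theorem mem_sup_pair_iff_coeff :
    z ∈ R ⊔ Algebra.adjoin K {x, y} ↔
      (∀ v, ∃ r ∈ R, (ρ z v : 𝓕) = r * P ^ (-v).toNat) ∧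
        z = ∑ v ∈ (ρ z).support, (ρ z v : 𝓕) * x ^ v := by
  rw [mem_sup_pair_iff_mem_span R hx hP hxy]
  exact mem_span_iff_coeff hρ hR fun v => pow_mem (hR hP) _

include hρ hR hx hP hxy in
theorem mem_sup_laurent'_iff_coeff (hy : y ≠ 0) :
    z ∈ R ⊔ Algebra.adjoin K {y, y⁻¹} ↔
      (∀ v, ∃ r ∈ R, (ρ z v : 𝓕) = r * P ^ (-v)) ∧
        z = ∑ v ∈ (ρ z).support, (ρ z v : 𝓕) * x ^ v := by
  rw [mem_sup_laurent'_iff_mem_span R hx hy hxy]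
  exact mem_span_iff_coeff hρ hR fun v => zpow_mem (show P ∈ E from hR hP) (-v)

end Coeff

/-- If `x * y = P` lies in `R`, then `R[x, x⁻¹] ∩ R[y, y⁻¹] = R[x, y]` (only the nontrivial
inclusion is stated). -/
theorem mem_sup_pair_of_mem_laurent (hx : Transcendental E x) {R : Subalgebra K 𝓕}
    (hR : R ≤ E.toSubalgebra) {y P : 𝓕} (hP : P ∈ R) (hxy : x * y = P) (hy : y ≠ 0) {z : 𝓕}
    (h1 : z ∈ R ⊔ Algebra.adjoin K {x, x⁻¹}) (h2 : z ∈ R ⊔ Algebra.adjoin K {y, y⁻¹}) :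
    z ∈ R ⊔ Algebra.adjoin K {x, y} := by
  obtain ⟨ρ, hρ⟩ := exists_coeff hx
  have hx0 := ne_zero_of_transcendental hx
  rw [mem_sup_laurent_iff_coeff hρ hR hx0] at h1
  rw [mem_sup_laurent'_iff_coeff hρ hR hx0 hP hxy hy] at h2
  rw [mem_sup_pair_iff_coeff hρ hR hx0 hP hxy]
  refine ⟨fun v => ?_, h1.2⟩
  rcases le_or_gt v 0 with hv | hv
  · obtain ⟨r, hr, h⟩ := h2.1 v
    refine ⟨r, hr, ?_⟩
    rw [h, ← zpow_natCast, Int.toNat_of_nonneg (by omega)]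
  · have : (-v).toNat = 0 := by omega
    exact ⟨_, h1.1 v, by simp [this]⟩

/-- Two commuting mutations: if `P₁` and `P₂` are relatively prime in `S`, an element which is a
Laurent polynomial after one mutation in either direction is so after both mutations. -/
theorem mem_pair_pair_of_relPrime {E₁ E₂ : IntermediateField K 𝓕} {x₁ x₂ y₁ y₂ P₁ P₂ : 𝓕}
    (h₁ : Transcendental E₁ x₁) (h₂ : Transcendental E₂ x₂) {S : Subalgebra K 𝓕}
    (hS₁ : S ≤ E₁.toSubalgebra) (hS₂ : S ⊔ Algebra.adjoin K {x₁, x₁⁻¹} ≤ E₂.toSubalgebra)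
    (hP₁ : P₁ ∈ S) (hP₂ : P₂ ∈ S) (h₁y : x₁ * y₁ = P₁) (h₂y : x₂ * y₂ = P₂)
    (hrel : ∀ (a b : ℕ), ∀ f ∈ S, ∀ g ∈ S, P₂ ^ a * f = P₁ ^ b * g → ∃ h ∈ S, f = P₁ ^ b * h)
    {z : 𝓕} (hz₁ : z ∈ (S ⊔ Algebra.adjoin K {x₁, y₁}) ⊔ Algebra.adjoin K {x₂, x₂⁻¹})
    (hz₂ : z ∈ (S ⊔ Algebra.adjoin K {x₁, x₁⁻¹}) ⊔ Algebra.adjoin K {x₂, y₂}) :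
    z ∈ (S ⊔ Algebra.adjoin K {x₁, y₁}) ⊔ Algebra.adjoin K {x₂, y₂} := by
  obtain ⟨ρ₁, hρ₁⟩ := exists_coeff h₁
  obtain ⟨ρ₂, hρ₂⟩ := exists_coeff h₂
  have hx₁ := ne_zero_of_transcendental h₁
  have hx₂ := ne_zero_of_transcendental h₂
  have hy₁ : y₁ = P₁ * x₁⁻¹ := by rw [← h₁y]; field_simp
  have hle : S ⊔ Algebra.adjoin K {x₁, y₁} ≤ S ⊔ Algebra.adjoin K {x₁, x₁⁻¹} := by
    refine sup_le le_sup_left (Algebra.adjoin_le ?_)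
    rintro w (rfl | hw)
    · exact (le_sup_right : _ ≤ S ⊔ _) (left_mem_adjoin_pair _ _)
    · rw [Set.mem_singleton_iff.1 hw, hy₁]
      exact mul_mem ((le_sup_left : S ≤ _) hP₁)
        ((le_sup_right : _ ≤ S ⊔ _) (right_mem_adjoin_pair _ _))
  rw [mem_sup_laurent_iff_coeff hρ₂ (hle.trans hS₂) hx₂] at hz₁
  rw [mem_sup_pair_iff_coeff hρ₂ hS₂ hx₂ ((le_sup_left : S ≤ _) hP₂) h₂y] at hz₂
  rw [mem_sup_pair_iff_coeff hρ₂ (hle.trans hS₂) hx₂ ((le_sup_left : S ≤ _) hP₂) h₂y]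
  refine ⟨fun v => ?_, hz₁.2⟩
  obtain ⟨g, hg, hgv⟩ := hz₂.1 v
  refine ⟨g, ?_, hgv⟩
  have hf := hz₁.1 v
  rw [hgv] at hf
  rw [mem_sup_laurent_iff_coeff hρ₁ hS₁ hx₁] at hg
  rw [mem_sup_pair_iff_coeff hρ₁ hS₁ hx₁ hP₁ h₁y] at hf ⊢
  refine ⟨fun w => ?_, hg.2⟩
  obtain ⟨r, hr, hrw⟩ := hf.1 w
  have hmul : g * P₂ ^ (-v).toNat = (⟨P₂ ^ (-v).toNat, pow_mem (hS₁ hP₂) _⟩ : E₁) • g :=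
    mul_comm _ _
  rw [hmul, map_smul] at hrw
  obtain ⟨h, hh, e⟩ := hrel (-v).toNat (-w).toNat _ (hg.1 w) r hr (by
    rw [mul_comm _ r, ← hrw]; rfl)
  exact ⟨h, hh, by rw [e, mul_comm]⟩

end OneVariable

end ClusterVariety

/-! ### Laurent polynomial subrings generated by algebraically independent elements -/

namespace ClusterVariety

section LaurentRing

variable {K 𝓕 κ : Type*} [Field K] [Field 𝓕] [Algebra K 𝓕]

/-- The subalgebra `K[y i, (y i)⁻¹ : i]` of `𝓕`. -/
def laurentRing (K : Type*) {𝓕 κ : Type*} [Field K] [Field 𝓕] [Algebra K 𝓕] (y : κ → 𝓕) :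
    Subalgebra K 𝓕 :=
  ⨆ i, Algebra.adjoin K {y i, (y i)⁻¹}

theorem mem_laurentRing (y : κ → 𝓕) (i : κ) : y i ∈ laurentRing K y :=
  le_iSup (fun i => Algebra.adjoin K {y i, (y i)⁻¹}) i (left_mem_adjoin_pair _ _)

theorem inv_mem_laurentRing (y : κ → 𝓕) (i : κ) : (y i)⁻¹ ∈ laurentRing K y :=
  le_iSup (fun i => Algebra.adjoin K {y i, (y i)⁻¹}) i (right_mem_adjoin_pair _ _)

theorem laurentRing_le_iff {y : κ → 𝓕} {A : Subalgebra K 𝓕} :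
    laurentRing K y ≤ A ↔ ∀ i, y i ∈ A ∧ (y i)⁻¹ ∈ A := by
  refine ⟨fun h i => ⟨h (mem_laurentRing y i), h (inv_mem_laurentRing y i)⟩, fun h => ?_⟩
  refine iSup_le fun i => Algebra.adjoin_le ?_
  rintro w (rfl | hw)
  · exact (h i).1
  · rw [Set.mem_singleton_iff.1 hw]; exact (h i).2

/-- The universal property of the ring of Laurent polynomials: a homomorphism may be prescribed on
algebraically independent elements `y i` by choosing units as their images. -/
theorem exists_algHom_laurentRing {y : κ → 𝓕} (hy : AlgebraicIndependent K y) {C : Type*}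
    [CommRing C] [Algebra K C] (u : κ → Cˣ) :
    ∃ φ : laurentRing K y →ₐ[K] C, ∀ i, φ ⟨y i, mem_laurentRing y i⟩ = u i := by
  have hy0 : ∀ i, y i ≠ 0 := hy.ne_zero
  -- the graph of `φ`, which projects isomorphically to the Laurent ring
  let Y : κ → 𝓕 × C := fun i => (y i, u i)
  let Z : κ → 𝓕 × C := fun i => ((y i)⁻¹, ↑(u i)⁻¹)
  let Γ : Subalgebra K (𝓕 × C) := Algebra.adjoin K (Set.range Y ∪ Set.range Z)
  have hfst : ∀ p, (MvPolynomial.aeval Y p).1 = MvPolynomial.aeval y p := fun p =>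
    DFunLike.congr_fun (MvPolynomial.algHom_ext
      (f := (AlgHom.fst K 𝓕 C).comp (MvPolynomial.aeval Y)) (g := MvPolynomial.aeval y)
      (by intro i; simp [Y])) p
  have hΓ : ∀ γ ∈ Γ, ∃ m p : MvPolynomial κ K, IsUnit (MvPolynomial.aeval Y m).2 ∧
      γ * MvPolynomial.aeval Y m = MvPolynomial.aeval Y p := by
    intro γ hγ
    induction hγ using Algebra.adjoin_induction with
    | mem γ hγ =>
      rcases hγ with ⟨i, rfl⟩ | ⟨i, rfl⟩
      · exact ⟨1, .X i, by simp, by simp⟩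
      · refine ⟨.X i, 1, by simp [Y], ?_⟩
        ext <;> simp [Y, Z, hy0 i]
    | algebraMap r => exact ⟨1, .C r, by simp, by simp⟩
    | add a b _ _ ha hb =>
      obtain ⟨m, p, h1, h2⟩ := ha
      obtain ⟨m', p', h1', h2'⟩ := hb
      refine ⟨m * m', p * m' + p' * m, ?_, ?_⟩
      · simpa using h1.mul h1'
      · simp only [map_mul, map_add, ← h2, ← h2']; ring
    | mul a b _ _ ha hb =>
      obtain ⟨m, p, h1, h2⟩ := ha
      obtain ⟨m', p', h1', h2'⟩ := hb
      refine ⟨m * m', p * p', ?_, ?_⟩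
      · simpa using h1.mul h1'
      · simp only [map_mul, ← h2, ← h2']; ring
  let π : Γ →ₐ[K] 𝓕 := (AlgHom.fst K 𝓕 C).comp Γ.val
  have hπ : Function.Injective π := by
    rw [injective_iff_map_eq_zero]
    rintro ⟨⟨a, c⟩, hγ⟩ h0
    obtain rfl : a = 0 := h0
    obtain ⟨m, p, h1, h2⟩ := hΓ _ hγ
    have h3 : MvPolynomial.aeval y p = 0 := by rw [← hfst, ← h2]; simp
    have h4 : p = 0 := hy (by rw [h3, map_zero])
    have h5 := congrArg Prod.snd h2
    rw [h4, map_zero] at h5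
    have h6 : c = 0 := (h1.mul_left_eq_zero).1 h5
    subst h6
    rfl
  have hrange : laurentRing K y ≤ π.range := by
    rw [laurentRing_le_iff]
    exact fun i => ⟨⟨⟨Y i, Algebra.subset_adjoin (Or.inl ⟨i, rfl⟩)⟩, rfl⟩,
      ⟨⟨Z i, Algebra.subset_adjoin (Or.inr ⟨i, rfl⟩)⟩, rfl⟩⟩
  let e := AlgEquiv.ofInjective π hπ
  refine ⟨(((AlgHom.snd K 𝓕 C).comp Γ.val).comp e.symm.toAlgHom).comp
    (Subalgebra.inclusion hrange), fun i => ?_⟩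
  have : e.symm (Subalgebra.inclusion hrange ⟨y i, mem_laurentRing y i⟩) =
      ⟨Y i, Algebra.subset_adjoin (Or.inl ⟨i, rfl⟩)⟩ := by
    rw [AlgEquiv.symm_apply_eq]; rfl
  exact congrArg (fun γ : Γ => (γ : 𝓕 × C).2) this

theorem algHom_laurentRing_ext {y : κ → 𝓕} (hy0 : ∀ i, y i ≠ 0) {C : Type*} [CommRing C]
    [Algebra K C] {φ ψ : laurentRing K y →ₐ[K] C}
    (h : ∀ i, φ ⟨y i, mem_laurentRing y i⟩ = ψ ⟨y i, mem_laurentRing y i⟩) : φ = ψ := by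
  have key : laurentRing K y ≤ (AlgHom.equalizer φ ψ).map (laurentRing K y).val := by
    rw [laurentRing_le_iff]
    intro i
    have hmul : (⟨y i, mem_laurentRing y i⟩ : laurentRing K y) *
        ⟨(y i)⁻¹, inv_mem_laurentRing y i⟩ = 1 := Subtype.ext (mul_inv_cancel₀ (hy0 i))
    refine ⟨⟨⟨y i, mem_laurentRing y i⟩, h i, rfl⟩,
      ⟨⟨(y i)⁻¹, inv_mem_laurentRing y i⟩, ?_, rfl⟩⟩
    have h1 := congrArg φ hmul
    have h2 := congrArg ψ hmul
    rw [map_mul, map_one] at h1 h2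
    have h3 : IsUnit (φ ⟨y i, mem_laurentRing y i⟩) := IsUnit.of_mul_eq_one _ h1
    refine h3.mul_left_cancel ?_
    rw [h1, h i, h2]
  ext a
  obtain ⟨b, hb, hba⟩ := key a.2
  obtain rfl : b = a := Subtype.ext hba
  exact hb

open LaurentPolynomial in
/-- In a Laurent polynomial ring, `1 + v T^c` with `c ≠ 0` and `v` a unit is not a zero divisor. -/
theorem eq_zero_of_one_add_mul_T_mul {Q : Type*} [CommRing Q] {v : Q} (hv : IsUnit v) {c : ℤ}
    (hc : c ≠ 0) {h : Q[T;T⁻¹]} (hh : (1 + C v * T c) * h = 0) : h = 0 := by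
  have hcoeff : ∀ n, h.coeff n + h.coeff (n - c) * v = 0 := by
    intro n
    have h1 : (1 + C v * T c) * h = h + h * AddMonoidAlgebra.single c v := by
      rw [single_eq_C_mul_T]; ring
    rw [h1] at hh
    have h2 := congrArg (fun p : Q[T;T⁻¹] => p.coeff n) hh
    simpa [sub_eq_add_neg, -single_eq_C_mul_T] using h2
  by_contra hne
  have hs : h.coeff.support.Nonempty := by
    rw [Finset.nonempty_iff_ne_empty]
    intro h0
    apply hne
    ext n
    simpa using congrArg (fun f => f n) (Finsupp.support_eq_empty.1 h0)
  -- an extremal exponent in the direction of `c`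
  obtain ⟨n, hn, hmax⟩ := h.coeff.support.exists_max_image (fun n => n * c) hs
  have hnc : h.coeff (n + c) = 0 := by
    by_contra hne
    have := hmax (n + c) (Finsupp.mem_support_iff.2 hne)
    have h2 : 0 < c * c := mul_self_pos.2 hc
    nlinarith
  have h3 := hcoeff (n + c)
  rw [hnc, add_sub_cancel_right, zero_add] at h3
  exact (Finsupp.mem_support_iff.1 hn) (hv.mul_left_eq_zero.1 h3)

/-- Under a substitution `y i ↦ y i * t ^ ℓ i`, the monomial `y ^ v` acquires the factor
`t ^ (∑ i, ℓ i * v i)`. -/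
theorem algHom_prod_zpow [Fintype κ] {A C : Type*} [CommRing A] [Algebra K A] [CommRing C]
    [Algebra K C] {c : A →+* C} {t : Cˣ} {Φ : A →ₐ[K] C} {U : κ → Aˣ} {ℓ : κ → ℤ}
    (hΦ : ∀ i, Φ (U i) = ↑(Units.map c.toMonoidHom (U i) * t ^ ℓ i)) (v : κ → ℤ) :
    Φ ↑(∏ i, U i ^ v i) = c ↑(∏ i, U i ^ v i) * ↑(t ^ ∑ i, ℓ i * v i) := by
  have h : Units.map (Φ : A →* C) (∏ i, U i ^ v i) =
      Units.map c.toMonoidHom (∏ i, U i ^ v i) * t ^ ∑ i, ℓ i * v i := by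
    have hpow : ∀ s : Finset κ, t ^ ∑ i ∈ s, ℓ i * v i = ∏ i ∈ s, t ^ (ℓ i * v i) := by
      intro s
      classical
      induction s using Finset.induction_on with
      | empty => simp
      | insert a s ha ih => rw [Finset.sum_insert ha, Finset.prod_insert ha, zpow_add, ih]
    rw [map_prod, map_prod, hpow, ← Finset.prod_mul_distrib]
    refine Finset.prod_congr rfl fun i _ => ?_
    rw [map_zpow, map_zpow, show Units.map (Φ : A →* C) (U i) = _ from Units.ext (hΦ i), mul_zpow,
      zpow_mul]
  exact congrArg Units.val h

open LaurentPolynomial in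
/-- The Laurent polynomial ring over `Q`, as an abstract extension with a distinguished unit `t`. -/
theorem exists_laurent_extension.{v} (Q : Type v) [CommRing Q] [Algebra K Q] :
    ∃ (C : Type v) (_ : CommRing C) (_ : Algebra K C) (c : Q →ₐ[K] C) (t : Cˣ) (ev : C →ₐ[K] Q),
      (∀ r, ev (c r) = r) ∧ ev t = 1 ∧ ∀ v : Q, IsUnit v → ∀ n : ℤ, n ≠ 0 → ∀ h : C,
        (1 + c v * ↑(t ^ n)) * h = 0 → h = 0 := by
  let t : (Q[T;T⁻¹])ˣ := ⟨T 1, T (-1), by rw [← T_add]; simp, by rw [← T_add]; simp⟩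
  have ht : ∀ m : ℤ, ((t ^ m : (Q[T;T⁻¹])ˣ) : Q[T;T⁻¹]) = T m := by
    intro m
    obtain ⟨k, rfl | rfl⟩ := m.eq_nat_or_neg
    · simp [t, T_pow]
    · rw [zpow_neg, zpow_natCast, ← inv_pow, Units.val_pow_eq_pow_val]
      change T (-1) ^ k = _
      rw [T_pow]; simp
  let ev : Q[T;T⁻¹] →+* Q := eval₂ (RingHom.id Q) 1
  refine ⟨Q[T;T⁻¹], inferInstance, inferInstance,
    (IsScalarTower.toAlgHom K Q Q[T;T⁻¹]), t, AlgHom.mk' ev ?_, ?_, ?_, ?_⟩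
  · intro r z
    rw [Algebra.smul_def, map_mul, Algebra.smul_def]
    congr 1
    change ev (C (algebraMap K Q r)) = _
    simp [ev]
  · intro r
    change ev (C r) = r
    simp [ev]
  · change ev (T 1) = 1
    simp [ev, eval₂_T]
  · intro v hv n hn h hh
    rw [ht] at hh
    exact eq_zero_of_one_add_mul_T_mul hv hn hh

/-- If a linear form `ℓ` vanishes on the exponent `u` but not on `w`, then `1 + y ^ u` and
`1 + y ^ w` are relatively prime. After the substitution `y i ↦ y i * t ^ ℓ i` the binomial
`1 + y ^ u` is unchanged, while `1 + y ^ w` becomes a nonzerodivisor modulo any ideal. -/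
theorem relPrime_binomials [Fintype κ] {y : κ → 𝓕} (hy : AlgebraicIndependent K y)
    {u w ℓ : κ → ℤ} (hu : ∑ i, ℓ i * u i = 0) (hw : ∑ i, ℓ i * w i ≠ 0) (a b : ℕ) {f g : 𝓕}
    (hf : f ∈ laurentRing K y) (hg : g ∈ laurentRing K y)
    (hfg : (1 + ∏ i, y i ^ w i) ^ a * f = (1 + ∏ i, y i ^ u i) ^ b * g) :
    ∃ h ∈ laurentRing K y, f = (1 + ∏ i, y i ^ u i) ^ b * h := by
  have hy0 : ∀ i, y i ≠ 0 := hy.ne_zero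
  let U : κ → (laurentRing K y)ˣ := fun i =>
    ⟨⟨y i, mem_laurentRing y i⟩, ⟨(y i)⁻¹, inv_mem_laurentRing y i⟩,
      Subtype.ext (mul_inv_cancel₀ (hy0 i)), Subtype.ext (inv_mul_cancel₀ (hy0 i))⟩
  have hU : ∀ v : κ → ℤ, ((↑(∏ i, U i ^ v i) : laurentRing K y) : 𝓕) = ∏ i, y i ^ v i := by
    intro v
    have h1 : ∀ z : (laurentRing K y)ˣ, ((z : laurentRing K y) : 𝓕) =
        Units.map ((laurentRing K y).val : laurentRing K y →* 𝓕) z := fun z => rfl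
    rw [h1, map_prod, Units.coe_prod]
    refine Finset.prod_congr rfl fun i _ => ?_
    rw [map_zpow, Units.val_zpow_eq_zpow_val]
    rfl
  let Au : laurentRing K y := (1 + ↑(∏ i, U i ^ u i)) ^ b
  let mk : laurentRing K y →ₐ[K] laurentRing K y ⧸ Ideal.span {Au} := Ideal.Quotient.mkₐ K _
  obtain ⟨C, _, _, c, t, ev, hevc, hevt, hreg⟩ :=
    exists_laurent_extension (K := K) (laurentRing K y ⧸ Ideal.span {Au})
  obtain ⟨Φ, hΦ⟩ := exists_algHom_laurentRing hy
    (fun i => Units.map (c.comp mk).toRingHom.toMonoidHom (U i) * t ^ ℓ i)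
  have hΦU : ∀ v : κ → ℤ, Φ ↑(∏ i, U i ^ v i) =
      c (mk ↑(∏ i, U i ^ v i)) * ↑(t ^ ∑ i, ℓ i * v i) :=
    fun v => algHom_prod_zpow (U := U) hΦ v
  -- the substitution `t = 1` recovers the quotient map
  have hev : ∀ z, ev (Φ z) = mk z := by
    have : ev.comp Φ = mk := by
      refine algHom_laurentRing_ext hy0 fun i => ?_
      change ev (Φ _) = _
      have ht : ev ↑(t ^ ℓ i) = 1 := by
        have h1 : Units.map ev.toRingHom.toMonoidHom t = 1 := Units.ext hevt
        have h2 : Units.map ev.toRingHom.toMonoidHom (t ^ ℓ i) = 1 := by rw [map_zpow, h1, one_zpow]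
        exact congrArg Units.val h2
      rw [hΦ, Units.val_mul, map_mul, ht, mul_one]
      exact hevc _
    exact fun z => DFunLike.congr_fun this z
  have hfg' : (1 + ↑(∏ i, U i ^ w i)) ^ a * (⟨f, hf⟩ : laurentRing K y) = Au * ⟨g, hg⟩ := by
    apply Subtype.ext
    simp only [Au, MulMemClass.coe_mul, SubmonoidClass.coe_pow, AddMemClass.coe_add,
      OneMemClass.coe_one, hU]
    exact hfg
  have h0 : Φ Au = 0 := by
    have h1 : Φ Au = c (mk Au) := by
      simp only [Au, map_pow, map_add, map_one, hΦU, hu, zpow_zero, Units.val_one, mul_one]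
    rw [h1, show mk Au = 0 from Ideal.Quotient.eq_zero_iff_mem.2
      (Ideal.subset_span rfl), map_zero]
  have h1 : Φ ⟨f, hf⟩ = 0 := by
    have h2 := congrArg Φ hfg'
    rw [map_mul, map_mul, h0, zero_mul, map_pow, map_add, map_one, hΦU] at h2
    have hun : IsUnit (mk ↑(∏ i, U i ^ w i)) := (Units.isUnit _).map mk
    have h3 : ∀ k : ℕ, ∀ h : C,
        (1 + c (mk ↑(∏ i, U i ^ w i)) * ↑(t ^ ∑ i, ℓ i * w i)) ^ k * h = 0 → h = 0 := by
      intro k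
      induction k with
      | zero => intro h hh; simpa using hh
      | succ k ih =>
        intro h hh
        rw [pow_succ, mul_assoc] at hh
        exact hreg _ hun _ hw _ (ih _ hh)
    exact h3 a _ h2
  have h2 : mk ⟨f, hf⟩ = 0 := by rw [← hev, h1, map_zero]
  obtain ⟨h, hh⟩ := Ideal.mem_span_singleton.1 (Ideal.Quotient.eq_zero_iff_mem.1 h2)
  refine ⟨h, h.2, ?_⟩
  have h3 := congrArg Subtype.val hh
  simp only [Au, MulMemClass.coe_mul, SubmonoidClass.coe_pow, AddMemClass.coe_add,
      OneMemClass.coe_one, hU] at h3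
  exact h3

end LaurentRing

end ClusterVariety

/-! ### Mutation of matrices and seeds -/

namespace ClusterVariety

namespace ExtMatrix

variable {n m : ℕ} {B : ExtMatrix n m}

theorem IsExchange.apply_self (hB : B.IsExchange) (k : Fin n) : B (Sum.inl k) k = 0 := by
  have := hB k k; omega

theorem mutate_apply_inl_self (B : ExtMatrix n m) (k j : Fin n) :
    B.mutate k (Sum.inl k) j = -B (Sum.inl k) j := by
  simp [mutate]

theorem mutate_apply_self (B : ExtMatrix n m) (i) (k : Fin n) : B.mutate k i k = -B i k := by
  simp [mutate]

theorem mutate_apply_of_ne (B : ExtMatrix n m) {i : Fin n ⊕ Fin m} {j k : Fin n}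
    (hi : i ≠ Sum.inl k) (hj : j ≠ k) : B.mutate k i j =
      B i j + max (B i k) 0 * max (B (Sum.inl k) j) 0 -
        min (B i k) 0 * min (B (Sum.inl k) j) 0 := by
  simp [mutate, hi, hj]

theorem IsExchange.mutate (hB : B.IsExchange) (k : Fin n) : (B.mutate k).IsExchange := by
  intro i j
  by_cases hi : i = k
  · subst hi; rw [mutate_apply_inl_self, mutate_apply_self, hB i j]
  by_cases hj : j = k
  · subst hj; rw [mutate_apply_inl_self, mutate_apply_self, hB i j]
  rw [mutate_apply_of_ne B (by simpa using hi) hj, mutate_apply_of_ne B (by simpa using hj) hi,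
    hB i j, hB i k, hB k j]
  have h1 : ∀ a : ℤ, max (-a) 0 = -min a 0 := fun a => by omega
  have h2 : ∀ a : ℤ, min (-a) 0 = -max a 0 := fun a => by omega
  rw [h1, h1, h2, h2]; ring

theorem mutate_mutate (B : ExtMatrix n m) (k : Fin n) : (B.mutate k).mutate k = B := by
  ext i j
  by_cases hi : i = Sum.inl k
  · subst hi; rw [mutate_apply_inl_self, mutate_apply_inl_self, neg_neg]
  by_cases hj : j = k
  · subst hj; rw [mutate_apply_self, mutate_apply_self, neg_neg]
  rw [mutate_apply_of_ne _ hi hj, mutate_apply_of_ne _ hi hj, mutate_apply_self,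
    mutate_apply_inl_self]
  have h1 : ∀ a : ℤ, max (-a) 0 = -min a 0 := fun a => by omega
  have h2 : ∀ a : ℤ, min (-a) 0 = -max a 0 := fun a => by omega
  rw [h1, h1, h2, h2]; ring

theorem mutate_neg (B : ExtMatrix n m) (k : Fin n) :
    mutate (-B : ExtMatrix n m) k = -(B.mutate k) := by
  ext i j
  rw [Matrix.neg_apply]
  by_cases hi : i = Sum.inl k
  · subst hi; rw [mutate_apply_inl_self, mutate_apply_inl_self, Matrix.neg_apply]
  by_cases hj : j = k
  · subst hj; rw [mutate_apply_self, mutate_apply_self, Matrix.neg_apply]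
  rw [mutate_apply_of_ne _ hi hj, mutate_apply_of_ne _ hi hj]
  simp only [Matrix.neg_apply]
  have h1 : ∀ a : ℤ, max (-a) 0 = -min a 0 := fun a => by omega
  have h2 : ∀ a : ℤ, min (-a) 0 = -max a 0 := fun a => by omega
  rw [h1, h1, h2, h2]; ring

/-- The columns of `B` are linearly independent. -/
def ColInjective (B : ExtMatrix n m) : Prop := ∀ v : Fin n → ℤ, B.mulVec v = 0 → v = 0

theorem FullRank.colInjective (hB : B.FullRank) : B.ColInjective := by
  intro v hv
  have hinj : Function.Injective (B.map (Int.cast : ℤ → ℚ)).mulVecLin := by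
    rw [← LinearMap.ker_eq_bot, ← Submodule.finrank_eq_zero]
    have h1 := LinearMap.finrank_range_add_finrank_ker (B.map (Int.cast : ℤ → ℚ)).mulVecLin
    have h2 : Module.finrank ℚ (LinearMap.range (B.map (Int.cast : ℤ → ℚ)).mulVecLin) = n := hB
    rw [h2] at h1
    simpa using h1
  have h1 : (B.map (Int.cast : ℤ → ℚ)).mulVecLin (fun j => (v j : ℚ)) = 0 := by
    funext i
    have := congrArg (Int.cast : ℤ → ℚ) (congrFun hv i)
    simpa [Matrix.mulVec, dotProduct] using this
  have h2 := hinj (h1.trans (map_zero _).symm)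
  funext j
  simpa using congrFun h2 j

theorem ColInjective.neg (hB : B.ColInjective) : ColInjective (-B : ExtMatrix n m) := by
  intro v hv
  rw [Matrix.neg_mulVec, neg_eq_zero] at hv
  exact hB v hv

/-- Matrix mutation is the composite of invertible row and column operations. -/
theorem ColInjective.mutate (hB : B.ColInjective) (hex : B.IsExchange) (k : Fin n) :
    (B.mutate k).ColInjective := by
  intro v hv
  -- the image of `v` under the column operation
  let c : ℤ := ∑ j, max (B (Sum.inl k) j) 0 * v j
  let v' : Fin n → ℤ := Function.update v k (c - v k)
  have hkk := hex.apply_self k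
  have hv' : ∀ i, B.mulVec v' i = ∑ j, B i j * v j + B i k * (c - 2 * v k) := by
    intro i
    have h1 : v' = v + Pi.single k (c - 2 * v k) := by
      funext j
      by_cases hj : j = k
      · subst hj; simp [v']; ring
      · simp [v', hj]
    rw [h1, Matrix.mulVec_add]
    simp [Matrix.mulVec, dotProduct]
  have hk : B.mulVec v' (Sum.inl k) = 0 := by
    have h1 := congrFun hv (Sum.inl k)
    rw [hv', hkk, zero_mul, add_zero]
    simp only [Matrix.mulVec, dotProduct, mutate_apply_inl_self, Pi.zero_apply, neg_mul,
      Finset.sum_neg_distrib] at h1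
    linarith
  have hmul : B.mulVec v' = 0 := by
    funext i
    by_cases hi : i = Sum.inl k
    · rw [hi, hk]; rfl
    have h1 := congrFun hv i
    simp only [Matrix.mulVec, dotProduct, Pi.zero_apply] at h1
    have h2 : ∀ j, B.mutate k i j * v j = B i j * v j +
        B i k * (max (B (Sum.inl k) j) 0 * v j) + max (-B i k) 0 * (B (Sum.inl k) j * v j)
        - (if j = k then 2 * B i k * v k else 0) := by
      intro j
      by_cases hj : j = k
      · subst hj; rw [mutate_apply_self, hkk]; simp; ring
      · rw [mutate_apply_of_ne B hi hj, if_neg hj]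
        have h3 : max (-B i k) 0 = -min (B i k) 0 := by omega
        have h4 : B i k = max (B i k) 0 + min (B i k) 0 := by omega
        have h5 : B (Sum.inl k) j = max (B (Sum.inl k) j) 0 + min (B (Sum.inl k) j) 0 := by omega
        rw [h3]
        linear_combination (-max (B (Sum.inl k) j) 0 * v j) * h4 + min (B i k) 0 * v j * h5
    rw [Finset.sum_congr rfl fun j _ => h2 j, Finset.sum_sub_distrib, Finset.sum_add_distrib,
      Finset.sum_add_distrib, ← Finset.mul_sum, ← Finset.mul_sum] at h1
    simp only [Finset.sum_ite_eq', Finset.mem_univ, if_true] at h1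
    rw [hv', hkk, zero_mul, add_zero] at hk
    rw [hk, mul_zero, add_zero] at h1
    rw [hv', Pi.zero_apply, ← h1]
    simp only [c]; ring
  have h0 := hB v' hmul
  have hvj : ∀ j, j ≠ k → v j = 0 := fun j hj => by
    have := congrFun h0 j
    simpa [v', hj] using this
  have hc : c = 0 := by
    refine Finset.sum_eq_zero fun j _ => ?_
    by_cases hj : j = k
    · subst hj; simp [hkk]
    · rw [hvj j hj, mul_zero]
  funext j
  by_cases hj : j = k
  · subst hj
    have := congrFun h0 j
    simpa [v', hc] using this
  · exact hvj j hj

theorem ColInjective.exists_ne_zero (hB : B.ColInjective) (k : Fin n) : ∃ i, B i k ≠ 0 := by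
  by_contra! h
  have := hB (Pi.single k 1) (by funext i; simp [Matrix.mulVec, dotProduct, Pi.single_apply, h])
  simpa using congrFun this k

/-- Two linearly independent columns have a nonvanishing `2 × 2` minor. -/
theorem ColInjective.exists_minor_ne_zero (hB : B.ColInjective) {j k : Fin n} (hjk : j ≠ k) :
    ∃ p r, B p k * B r j - B r k * B p j ≠ 0 := by
  by_contra! h
  obtain ⟨p, hp⟩ := hB.exists_ne_zero k
  have h0 := hB (Pi.single j (B p k) - Pi.single k (B p j)) (by
    funext r
    rw [Matrix.mulVec_sub]
    have := h p r
    simp [Matrix.mulVec_single]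
    linarith)
  have := congrFun h0 j
  simp [hjk] at this
  exact hp this

/-- The exchange binomial in direction `k`, evaluated at the point `x`. -/
def exchange {R : Type*} [CommSemiring R] (B : ExtMatrix n m) (x : Fin n ⊕ Fin m → R)
    (k : Fin n) : R :=
  ∏ i, x i ^ (B i k).toNat + ∏ i, x i ^ (-B i k).toNat

theorem exchange_neg {R : Type*} [CommSemiring R] (B : ExtMatrix n m) (x : Fin n ⊕ Fin m → R)
    (k : Fin n) : exchange (-B) x k = B.exchange x k := by
  simp only [exchange, Matrix.neg_apply, neg_neg]
  exact add_comm _ _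

theorem map_exchange {R S F : Type*} [CommSemiring R] [CommSemiring S] [FunLike F R S]
    [RingHomClass F R S] (B : ExtMatrix n m) (φ : F) (x : Fin n ⊕ Fin m → R) (k : Fin n) :
    φ (B.exchange x k) = B.exchange (fun i => φ (x i)) k := by
  simp [exchange]

theorem exchange_congr {R : Type*} [CommSemiring R] {B B' : ExtMatrix n m}
    {x x' : Fin n ⊕ Fin m → R} {k : Fin n} (hB : ∀ i, B i k = B' i k)
    (hx : ∀ i, B i k ≠ 0 → x i = x' i) : B.exchange x k = B'.exchange x' k := by
  unfold exchange
  congr 1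
  all_goals
    refine Finset.prod_congr rfl fun i _ => ?_
    by_cases h : B i k = 0
    · simp [← hB, h]
    · rw [← hB, hx i h]

theorem exchange_mem {R S : Type*} [CommSemiring R] [SetLike S R] [SubsemiringClass S R] {A : S}
    {B : ExtMatrix n m} {x : Fin n ⊕ Fin m → R} {k : Fin n}
    (h : ∀ i, B i k ≠ 0 → x i ∈ A) : B.exchange x k ∈ A := by
  refine add_mem (prod_mem fun i _ => ?_) (prod_mem fun i _ => ?_)
  all_goals
    by_cases h0 : B i k = 0
    · simp [h0]
    · exact pow_mem (h i h0) _

end ExtMatrix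

namespace SeedData

variable {K 𝓕 : Type*} [Field K] [Field 𝓕] [Algebra K 𝓕] {n m : ℕ}

/-- The properties of a seed of full rank that are preserved under mutation and used below. -/
structure IsRegular (K : Type*) [Field K] [Algebra K 𝓕] (s : SeedData 𝓕 n m) : Prop where
  algebraicIndependent : AlgebraicIndependent K s.x
  isExchange : s.B.IsExchange
  colInjective : s.B.ColInjective

/-- The cluster variable replacing `x k` under mutation in direction `k`. -/
noncomputable def x' (s : SeedData 𝓕 n m) (k : Fin n) : 𝓕 := s.B.exchange s.x k / s.x (Sum.inl k)

theorem mutate_x (s : SeedData 𝓕 n m) (k : Fin n) :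
    (s.mutate k).x = Function.update s.x (Sum.inl k) (s.x' k) := rfl

theorem mutate_x_self (s : SeedData 𝓕 n m) (k : Fin n) :
    (s.mutate k).x (Sum.inl k) = s.x' k := by
  rw [mutate_x, Function.update_self]

theorem mutate_x_of_ne (s : SeedData 𝓕 n m) {k : Fin n} {i} (hi : i ≠ Sum.inl k) :
    (s.mutate k).x i = s.x i := by
  rw [mutate_x, Function.update_of_ne hi]

namespace IsRegular

variable {s : SeedData 𝓕 n m}

theorem x_ne_zero (hs : s.IsRegular K) (i) : s.x i ≠ 0 := hs.algebraicIndependent.ne_zero i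

theorem exchange_ne_zero (hs : s.IsRegular K) (k : Fin n) : s.B.exchange s.x k ≠ 0 := by
  classical
  obtain ⟨i, hi⟩ := hs.colInjective.exists_ne_zero k
  let a : Fin n ⊕ Fin m →₀ ℕ := Finsupp.equivFunOnFinite.symm fun i => (s.B i k).toNat
  let b : Fin n ⊕ Fin m →₀ ℕ := Finsupp.equivFunOnFinite.symm fun i => (-s.B i k).toNat
  have hab : b ≠ a := by
    intro h
    have := DFunLike.congr_fun h i
    simp only [a, b, Finsupp.equivFunOnFinite_symm_apply_apply] at this
    omega
  have hp : (MvPolynomial.monomial a 1 + MvPolynomial.monomial b 1 :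
      MvPolynomial (Fin n ⊕ Fin m) K) ≠ 0 := by
    intro h
    have := congrArg (MvPolynomial.coeff a) h
    simp [MvPolynomial.coeff_monomial, hab] at this
  intro h0
  apply hp
  apply hs.algebraicIndependent
  rw [map_zero, map_add, MvPolynomial.aeval_monomial, MvPolynomial.aeval_monomial,
    Finsupp.prod_fintype _ _ (by simp), Finsupp.prod_fintype _ _ (by simp)]
  simpa [a, b, ExtMatrix.exchange] using h0

theorem x_mul_x' (hs : s.IsRegular K) (k : Fin n) :
    s.x (Sum.inl k) * s.x' k = s.B.exchange s.x k := by
  unfold x'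
  rw [mul_div_cancel₀ _ (hs.x_ne_zero _)]

theorem transcendental (hs : s.IsRegular K) (i) :
    Transcendental (IntermediateField.adjoin K (s.x '' {i}ᶜ)) (s.x i) := by
  rw [IntermediateField.transcendental_adjoin_iff]
  exact ((AlgebraicIndependent.iff_transcendental_adjoin_image i).1 hs.algebraicIndependent).2

theorem mutate (hs : s.IsRegular K) (k : Fin n) : (s.mutate k).IsRegular K where
  isExchange := hs.isExchange.mutate k
  colInjective := hs.colInjective.mutate hs.isExchange k
  algebraicIndependent := by
    have h1 := (AlgebraicIndependent.iff_transcendental_adjoin_image (Sum.inl k)).1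
      hs.algebraicIndependent
    rw [AlgebraicIndependent.iff_transcendental_adjoin_image (Sum.inl k)]
    constructor
    · convert h1.1 using 1
      funext j
      exact s.mutate_x_of_ne j.2
    · have himage : (s.mutate k).x '' {Sum.inl k}ᶜ = s.x '' {Sum.inl k}ᶜ :=
        Set.image_congr fun i hi => s.mutate_x_of_ne hi
      rw [himage, mutate_x_self, ← IntermediateField.transcendental_adjoin_iff]
      intro halg
      refine hs.transcendental (Sum.inl k) ?_
      have hP : s.B.exchange s.x k ∈ IntermediateField.adjoin K (s.x '' {Sum.inl k}ᶜ) := by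
        refine ExtMatrix.exchange_mem fun i hi => IntermediateField.subset_adjoin _ _ ⟨i, ?_, rfl⟩
        rintro rfl
        exact hi (hs.isExchange.apply_self k)
      have hx : s.x (Sum.inl k) = s.B.exchange s.x k * (s.x' k)⁻¹ := by
        unfold x'
        have := hs.exchange_ne_zero k
        field_simp
      rw [hx]
      exact (isAlgebraic_algebraMap (⟨_, hP⟩ :
        IntermediateField.adjoin K (s.x '' {Sum.inl k}ᶜ))).mul halg.inv

theorem mutate_mutate (hs : s.IsRegular K) (k : Fin n) : (s.mutate k).mutate k = s := by
  have hB : ((s.mutate k).mutate k).B = s.B := s.B.mutate_mutate k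
  have hx : ((s.mutate k).mutate k).x = s.x := by
    funext i
    by_cases hi : i = Sum.inl k
    · subst hi
      rw [mutate_x_self, x', mutate_x_self]
      have h1 : (s.mutate k).B.exchange (s.mutate k).x k = s.B.exchange s.x k := by
        rw [← ExtMatrix.exchange_neg s.B]
        refine ExtMatrix.exchange_congr (fun i => s.B.mutate_apply_self i k) fun i hi => ?_
        refine s.mutate_x_of_ne ?_
        rintro rfl
        exact hi ((hs.isExchange.mutate k).apply_self k)
      rw [h1, x']
      have := hs.exchange_ne_zero k
      have := hs.x_ne_zero (Sum.inl k)
      field_simp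
    · rw [mutate_x_of_ne _ hi, mutate_x_of_ne _ hi]
  cases h : (s.mutate k).mutate k
  cases s
  simp_all

theorem reaches (hs : s.IsRegular K) {t : SeedData 𝓕 n m} (hst : s.Reaches t) : t.IsRegular K := by
  induction hst with
  | refl => exact hs
  | tail _ h ih => obtain ⟨k, rfl⟩ := h; exact ih.mutate k

end IsRegular

theorem IsSeed.isRegular {s : SeedData 𝓕 n m} (hs : s.IsSeed K) (hr : s.B.FullRank) :
    s.IsRegular K :=
  ⟨hs.algebraicIndependent, hs.isExchange, hr.colInjective⟩

end SeedData

end ClusterVariety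

/-! ### The Laurent phenomenon -/

namespace ClusterVariety

section Ring

variable {K 𝓕 : Type*} [Field K] [Field 𝓕] [Algebra K 𝓕]

/-- The subalgebra of fractions `d / w` with `d` in the subalgebra `D` and `w` in the multiplicative
set `M ⊆ D`. -/
def fracAlg (D : Subalgebra K 𝓕) (M : Submonoid 𝓕) (hM : ∀ w ∈ M, w ∈ D) : Subalgebra K 𝓕 where
  carrier := {z | ∃ w ∈ M, w * z ∈ D}
  mul_mem' := by
    rintro a b ⟨w, hw, h1⟩ ⟨v, hv, h2⟩
    exact ⟨w * v, mul_mem hw hv, by rw [mul_mul_mul_comm]; exact mul_mem h1 h2⟩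
  add_mem' := by
    rintro a b ⟨w, hw, h1⟩ ⟨v, hv, h2⟩
    refine ⟨w * v, mul_mem hw hv, ?_⟩
    have : w * v * (a + b) = v * (w * a) + w * (v * b) := by ring
    rw [this]
    exact add_mem (mul_mem (hM v hv) h1) (mul_mem (hM w hw) h2)
  algebraMap_mem' r := ⟨1, one_mem _, by simp⟩

theorem le_fracAlg {D : Subalgebra K 𝓕} {M : Submonoid 𝓕} {hM : ∀ w ∈ M, w ∈ D} :
    D ≤ fracAlg D M hM := fun z hz => ⟨1, one_mem _, by simpa using hz⟩

theorem inv_mem_fracAlg {D : Subalgebra K 𝓕} {M : Submonoid 𝓕} {hM : ∀ w ∈ M, w ∈ D} {w : 𝓕}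
    (hw : w ∈ M) (h0 : w ≠ 0) : w⁻¹ ∈ fracAlg D M hM :=
  ⟨w, hw, by rw [mul_inv_cancel₀ h0]; exact one_mem _⟩

theorem adjoin_pair_le_iff {x y : 𝓕} {A : Subalgebra K 𝓕} :
    Algebra.adjoin K {x, y} ≤ A ↔ x ∈ A ∧ y ∈ A := by
  rw [Algebra.adjoin_le_iff, Set.insert_subset_iff, Set.singleton_subset_iff]; rfl

/-- Elements with coprime denominators `w` and `v` over `D` lie in `D`. -/
theorem mem_of_isCoprime {D : Subalgebra K 𝓕} {w v z : 𝓕} {p q : 𝓕} (hw : w ∈ D) (hv : v ∈ D)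
    (hp : p ∈ D) (hq : q ∈ D) (hpq : p * w + q * v = 1) {a b : ℕ} (ha : w ^ a * z ∈ D)
    (hb : v ^ b * z ∈ D) : z ∈ D := by
  have h : IsCoprime (⟨w, hw⟩ : D) ⟨v, hv⟩ := ⟨⟨p, hp⟩, ⟨q, hq⟩, Subtype.ext hpq⟩
  obtain ⟨p', q', h'⟩ := h.pow (m := a) (n := b)
  have h1 : (p' : 𝓕) * w ^ a + q' * v ^ b = 1 := congrArg Subtype.val h'
  have h2 : z = p' * (w ^ a * z) + q' * (v ^ b * z) := by
    linear_combination (-z) * h1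
  rw [h2]
  exact add_mem (mul_mem p'.2 ha) (mul_mem q'.2 hb)

/-- Two non-commuting mutations `x₁ ↦ y₁`, `x₂ ↦ w₂`, in the order first `x₁`. Here `x₂ ↦ y₂` is
the mutation of the original seed. Over `D = S[y₁, y₁⁻¹][x₂, w₂]` the denominators `P₁` and `x₂`
are comaximal, since `P₁` is invertible modulo `x₂`. -/
theorem mem_laurent_of_noncommuting {S : Subalgebra K 𝓕} {x₁ x₂ y₁ y₂ w₂ A C M Q M' Q' : 𝓕}
    {b : ℕ} (hb : b ≠ 0) (hx₁ : x₁ ≠ 0) (hx₂ : x₂ ≠ 0) (hy₁ : y₁ ≠ 0) (hw₂ : w₂ ≠ 0)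
    (hC0 : C ≠ 0) (hM'0 : M' ≠ 0)
    (hA : A ∈ S) (hC : C ∈ S) (hCi : C⁻¹ ∈ S) (hQ : Q ∈ S)
    (hM' : M' ∈ S) (hM'i : M'⁻¹ ∈ S) (hQ' : Q' ∈ S)
    (h₁ : x₁ * y₁ = A * x₂ ^ b + C) (h₂ : x₂ * y₂ = M + Q * x₁ ^ b)
    (h₂' : x₂ * w₂ = M' + Q' * y₁ ^ b) (hid : Q * Q' * C ^ b = M * M') {z : 𝓕}
    (hz₁ : z ∈ S ⊔ Algebra.adjoin K {x₁, x₁⁻¹} ⊔ Algebra.adjoin K {x₂, y₂})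
    (hz₂ : z ∈ S ⊔ Algebra.adjoin K {y₁, y₁⁻¹} ⊔ Algebra.adjoin K {x₂, x₂⁻¹}) :
    z ∈ S ⊔ Algebra.adjoin K {y₁, y₁⁻¹} ⊔ Algebra.adjoin K {w₂, w₂⁻¹} := by
  set D := S ⊔ Algebra.adjoin K {y₁, y₁⁻¹} ⊔ Algebra.adjoin K {x₂, w₂} with hD
  have hSD : S ≤ D := le_sup_left.trans le_sup_left
  have hyD : Algebra.adjoin K {y₁, y₁⁻¹} ≤ D := le_sup_right.trans le_sup_left
  have hxD : Algebra.adjoin K {x₂, w₂} ≤ D := le_sup_right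
  rw [adjoin_pair_le_iff] at hyD hxD
  set P := A * x₂ ^ b + C with hP
  have hPD : P ∈ D := add_mem (mul_mem (hSD hA) (pow_mem hxD.1 _)) (hSD hC)
  have hx₁D : x₁ ∈ D := by
    have : x₁ = P * y₁⁻¹ := by rw [← h₁]; field_simp
    rw [this]; exact mul_mem hPD hyD.2
  -- modulo `x₂` one has `x₁ * y₁ = C`, so that by `hid` the element `M + Q * x₁ ^ b` is a unit
  -- times `M' + Q' * y₁ ^ b`, and therefore divisible by `x₂` in `D`
  have hy₂D : y₂ ∈ D := by
    obtain ⟨G, hG⟩ := sub_dvd_pow_sub_pow (⟨P, hPD⟩ : D) ⟨C, hSD hC⟩ b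
    have hG' : P ^ b - C ^ b = (P - C) * G := congrArg Subtype.val hG
    obtain ⟨c, rfl⟩ := Nat.exists_eq_succ_of_ne_zero hb
    have hPC : P - C = x₂ * (A * x₂ ^ c) := by rw [hP, pow_succ]; ring
    rw [hPC] at hG'
    have e1 : y₁ ^ c.succ * x₁ ^ c.succ = P ^ c.succ := by rw [← h₁, mul_pow, mul_comm]
    have : y₂ = (y₁⁻¹) ^ c.succ * (Q * M'⁻¹) * (C ^ c.succ * w₂ + M' * (A * x₂ ^ c * G)) := by
      have h3 : x₂ * M' * y₁ ^ c.succ * y₂ =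
          x₂ * (Q * (C ^ c.succ * w₂ + M' * (A * x₂ ^ c * G))) := by
        linear_combination (M' * y₁ ^ c.succ) * h₂ + Q * M' * e1 - Q * C ^ c.succ * h₂'
          + Q * M' * hG' - y₁ ^ c.succ * hid
      rw [mul_assoc, mul_assoc] at h3
      have h4 := mul_left_cancel₀ hx₂ h3
      rw [inv_pow]
      field_simp
      linear_combination h4
    rw [this]
    refine mul_mem (mul_mem (pow_mem hyD.2 _) (mul_mem (hSD hQ) (hSD hM'i))) (add_mem
      (mul_mem (pow_mem (hSD hC) _) hxD.2) (mul_mem (hSD hM') (mul_mem (mul_mem (hSD hA)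
        (pow_mem hxD.1 _)) G.2)))
  have hpow : ∀ d ∈ D, ∀ w ∈ Submonoid.powers d, w ∈ D := by
    rintro d hd _ ⟨k, rfl⟩; exact pow_mem hd k
  have hz₁' : z ∈ fracAlg D (Submonoid.powers P) (hpow P hPD) := by
    refine (sup_le (sup_le (hSD.trans le_fracAlg) ?_) ?_ : _ ≤ fracAlg D _ _) hz₁
    · refine adjoin_pair_le_iff.2 ⟨le_fracAlg hx₁D, P, ⟨1, pow_one P⟩, ?_⟩
      rw [← h₁, mul_right_comm, mul_inv_cancel₀ hx₁, one_mul]; exact hyD.1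
    · exact adjoin_pair_le_iff.2 ⟨le_fracAlg hxD.1, le_fracAlg hy₂D⟩
  have hz₂' : z ∈ fracAlg D (Submonoid.powers x₂) (hpow x₂ hxD.1) := by
    refine (sup_le (le_trans ?_ le_fracAlg) ?_ : _ ≤ fracAlg D _ _) hz₂
    · exact le_sup_left
    · exact adjoin_pair_le_iff.2 ⟨le_fracAlg hxD.1, inv_mem_fracAlg ⟨1, pow_one _⟩ hx₂⟩
  obtain ⟨_, ⟨a, rfl⟩, ha⟩ := hz₁'
  obtain ⟨_, ⟨c, rfl⟩, hc⟩ := hz₂'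
  have hzD : z ∈ D := by
    refine mem_of_isCoprime (p := C⁻¹) (q := -C⁻¹ * A * x₂ ^ (b - 1)) hPD hxD.1 (hSD hCi)
      (mul_mem (mul_mem (neg_mem (hSD hCi)) (hSD hA)) (pow_mem hxD.1 _)) ?_ ha hc
    obtain ⟨e, rfl⟩ := Nat.exists_eq_succ_of_ne_zero hb
    rw [hP, Nat.succ_sub_one, pow_succ]
    field_simp
    ring
  refine (sup_le le_sup_left (adjoin_pair_le_iff.2 ⟨?_, ?_⟩) : D ≤ _) hzD
  · have : x₂ = (M' + Q' * y₁ ^ b) * w₂⁻¹ := by rw [← h₂']; field_simp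
    rw [this]
    refine mul_mem ((le_sup_left : S ⊔ _ ≤ _) (add_mem ((le_sup_left : S ≤ _) hM')
      (mul_mem ((le_sup_left : S ≤ _) hQ') (pow_mem ((le_sup_right : _ ≤ S ⊔ _)
        (left_mem_adjoin_pair _ _)) _))))
      ((le_sup_right : _ ≤ S ⊔ _ ⊔ _) (right_mem_adjoin_pair _ _))
  · exact (le_sup_right : _ ≤ S ⊔ _ ⊔ _) (left_mem_adjoin_pair _ _)

variable {κ : Type*}

theorem laurentRing_eq_sup [DecidableEq κ] (y : κ → 𝓕) (a b : κ) :
    laurentRing K y = laurentRing K (fun i : {i // i ≠ a ∧ i ≠ b} => y i) ⊔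
      Algebra.adjoin K {y a, (y a)⁻¹} ⊔ Algebra.adjoin K {y b, (y b)⁻¹} := by
  apply le_antisymm
  · rw [laurentRing_le_iff]
    intro i
    rw [← adjoin_pair_le_iff]
    by_cases ha : i = a
    · subst ha; exact le_sup_right.trans le_sup_left
    by_cases hb : i = b
    · subst hb; exact le_sup_right
    · refine le_trans ?_ (le_sup_left.trans le_sup_left)
      exact le_iSup (fun i : {i // i ≠ a ∧ i ≠ b} => Algebra.adjoin K {y i, (y i)⁻¹}) ⟨i, ha, hb⟩
  · refine sup_le (sup_le ?_ (le_iSup (fun i => Algebra.adjoin K {y i, (y i)⁻¹}) a))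
      (le_iSup (fun i => Algebra.adjoin K {y i, (y i)⁻¹}) b)
    rw [laurentRing_le_iff]
    exact fun i => ⟨mem_laurentRing y i, inv_mem_laurentRing y i⟩

theorem prod_eq_prod_subtype_mul_mul {R : Type*} [CommMonoid R] [Fintype κ] [DecidableEq κ]
    {a b : κ} (hab : a ≠ b) (g : κ → R) :
    ∏ i, g i = (∏ i : {i // i ≠ a ∧ i ≠ b}, g i) * g a * g b := by
  rw [← Finset.mul_prod_erase Finset.univ g (Finset.mem_univ b),
    ← Finset.mul_prod_erase (Finset.univ.erase b) g (Finset.mem_erase.2 ⟨hab, Finset.mem_univ a⟩),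
    Finset.prod_subtype ((Finset.univ.erase b).erase a) (p := fun i => i ≠ a ∧ i ≠ b) (by simp) g]
  rw [mul_comm, mul_comm (g a)]

theorem prod_mem_laurentRing [Fintype κ] (y : κ → 𝓕) (e : κ → ℕ) :
    ∏ i, y i ^ e i ∈ laurentRing K y :=
  prod_mem fun i _ => pow_mem (mem_laurentRing y i) _

theorem prod_inv_mem_laurentRing [Fintype κ] (y : κ → 𝓕) (e : κ → ℕ) :
    (∏ i, y i ^ e i)⁻¹ ∈ laurentRing K y := by
  rw [← Finset.prod_inv_distrib]
  refine prod_mem fun i _ => ?_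
  rw [← inv_pow]
  exact pow_mem (inv_mem_laurentRing y i) _

end Ring

namespace ExtMatrix

/-- The exchange binomial as a monomial times `1 + y ^ u`, when the rows `a` and `b` vanish. -/
theorem exchange_eq_mul_binomial {𝓕 : Type*} [Field 𝓕] {n m : ℕ} {B : ExtMatrix n m}
    {x : Fin n ⊕ Fin m → 𝓕} (hx : ∀ i, x i ≠ 0) {a b : Fin n ⊕ Fin m} (hab : a ≠ b) {k : Fin n}
    (ha : B a k = 0) (hb : B b k = 0) :
    B.exchange x k = (∏ i : {i // i ≠ a ∧ i ≠ b}, x i ^ (-B i k).toNat) *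
      (1 + ∏ i : {i // i ≠ a ∧ i ≠ b}, x i ^ B i k) := by
  rw [ExtMatrix.exchange, prod_eq_prod_subtype_mul_mul hab, prod_eq_prod_subtype_mul_mul hab, ha,
    hb, mul_add, ← Finset.prod_mul_distrib, add_comm]
  simp only [neg_zero, Int.toNat_zero, pow_zero, mul_one, add_right_inj]
  refine Finset.prod_congr rfl fun i _ => ?_
  rw [← zpow_natCast, ← zpow_natCast, ← zpow_add₀ (hx i)]
  congr 1
  omega

end ExtMatrix

namespace SeedData

variable {K 𝓕 : Type*} [Field K] [Field 𝓕] [Algebra K 𝓕] {n m : ℕ} {s : SeedData 𝓕 n m}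

/-- The exchange binomials in two non-adjacent directions are relatively prime Laurent polynomials
in the other variables, because the two columns are linearly independent. -/
theorem IsRegular.relPrime (hs : s.IsRegular K) {j k : Fin n} (hjk : j ≠ k)
    (h0 : s.B (Sum.inl j) k = 0) (a b : ℕ) {f g : 𝓕}
    (hf : f ∈ laurentRing K (fun i : {i : Fin n ⊕ Fin m // i ≠ Sum.inl k ∧ i ≠ Sum.inl j} => s.x i))
    (hg : g ∈ laurentRing K (fun i : {i : Fin n ⊕ Fin m // i ≠ Sum.inl k ∧ i ≠ Sum.inl j} => s.x i))
    (hfg : s.B.exchange s.x j ^ a * f = s.B.exchange s.x k ^ b * g) :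
    ∃ h ∈ laurentRing K (fun i : {i : Fin n ⊕ Fin m // i ≠ Sum.inl k ∧ i ≠ Sum.inl j} => s.x i),
      f = s.B.exchange s.x k ^ b * h := by
  have h0' : s.B (Sum.inl k) j = 0 := by rw [hs.isExchange k j, h0, neg_zero]
  have hkj : (Sum.inl k : Fin n ⊕ Fin m) ≠ Sum.inl j := by simpa using hjk.symm
  have hkk := hs.isExchange.apply_self k
  have hjj := hs.isExchange.apply_self j
  rw [ExtMatrix.exchange_eq_mul_binomial hs.x_ne_zero hkj hkk h0] at hfg ⊢
  rw [ExtMatrix.exchange_eq_mul_binomial hs.x_ne_zero hkj h0' hjj] at hfg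
  set y : {i : Fin n ⊕ Fin m // i ≠ Sum.inl k ∧ i ≠ Sum.inl j} → 𝓕 := fun i => s.x i with hy
  have hyi : AlgebraicIndependent K y := hs.algebraicIndependent.comp _ Subtype.val_injective
  have hNk0 : ∏ i, y i ^ (-s.B i k).toNat ≠ 0 :=
    Finset.prod_ne_zero_iff.2 fun i _ => pow_ne_zero _ (hs.x_ne_zero _)
  have hNj0 : ∏ i, y i ^ (-s.B i j).toNat ≠ 0 :=
    Finset.prod_ne_zero_iff.2 fun i _ => pow_ne_zero _ (hs.x_ne_zero _)
  have hNk := prod_mem_laurentRing (K := K) y (fun i => (-s.B i k).toNat)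
  have hNki := prod_inv_mem_laurentRing (K := K) y (fun i => (-s.B i k).toNat)
  have hNji := prod_inv_mem_laurentRing (K := K) y (fun i => (-s.B i j).toNat)
  change ((∏ i, y i ^ (-s.B i j).toNat) * (1 + ∏ i, y i ^ s.B i j)) ^ a * f =
    ((∏ i, y i ^ (-s.B i k).toNat) * (1 + ∏ i, y i ^ s.B i k)) ^ b * g at hfg
  change ∃ h ∈ laurentRing K y,
    f = ((∏ i, y i ^ (-s.B i k).toNat) * (1 + ∏ i, y i ^ s.B i k)) ^ b * h
  generalize ∏ i, y i ^ (-s.B i k).toNat = Nk at *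
  generalize ∏ i, y i ^ (-s.B i j).toNat = Nj at *
  -- a nonvanishing `2 × 2` minor provides the linear form; its rows are not among the removed ones
  obtain ⟨p, r, hpr⟩ := hs.colInjective.exists_minor_ne_zero hjk
  have hp : p ≠ Sum.inl k ∧ p ≠ Sum.inl j := by
    constructor <;> rintro rfl
    · rw [hkk, h0'] at hpr; simp at hpr
    · rw [hjj, h0] at hpr; simp at hpr
  have hr : r ≠ Sum.inl k ∧ r ≠ Sum.inl j := by
    constructor <;> rintro rfl
    · rw [hkk, h0'] at hpr; simp at hpr
    · rw [hjj, h0] at hpr; simp at hpr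
  let ℓ : {i : Fin n ⊕ Fin m // i ≠ Sum.inl k ∧ i ≠ Sum.inl j} → ℤ :=
    Pi.single ⟨p, hp⟩ (-s.B r k) + Pi.single ⟨r, hr⟩ (s.B p k)
  have hsum : ∀ c : Fin n, ∑ i, ℓ i * s.B i c = s.B p k * s.B r c - s.B r k * s.B p c := by
    intro c
    simp only [ℓ, Pi.add_apply, add_mul, Finset.sum_add_distrib, Pi.single_apply, ite_mul, zero_mul,
      Finset.sum_ite_eq', Finset.mem_univ, if_true]
    ring
  obtain ⟨h, hh, e⟩ := relPrime_binomials hyi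
    (u := fun i => s.B i k) (w := fun i => s.B i j)
    (ℓ := ℓ)
    ((hsum k).trans (by ring)) ((hsum j).trans_ne hpr) a b hf
    (mul_mem (mul_mem (pow_mem hNji a) (pow_mem hNk b)) hg) (by
      rw [mul_pow, mul_pow] at hfg
      have : Nj ^ a * Nj⁻¹ ^ a = 1 := by rw [← mul_pow, mul_inv_cancel₀ hNj0, one_pow]
      linear_combination Nj⁻¹ ^ a * hfg - (1 + ∏ i, y i ^ s.B i j) ^ a * f * this)
  refine ⟨Nk⁻¹ ^ b * h, mul_mem (pow_mem hNki b) hh, ?_⟩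
  rw [e, mul_pow]
  have : Nk ^ b * Nk⁻¹ ^ b = 1 := by rw [← mul_pow, mul_inv_cancel₀ hNk0, one_pow]
  linear_combination (-(1 + ∏ i, y i ^ s.B i k) ^ b * h) * this

end SeedData

end ClusterVariety

namespace ClusterVariety

namespace SeedData

variable {K 𝓕 : Type*} [Field K] [Field 𝓕] [Algebra K 𝓕] {n m : ℕ} {s : SeedData 𝓕 n m}

theorem IsRegular.x'_ne_zero (hs : s.IsRegular K) (k : Fin n) : s.x' k ≠ 0 :=
  div_ne_zero (hs.exchange_ne_zero k) (hs.x_ne_zero _)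

/-- The ring of Laurent polynomials in the variables other than `x k` and `x j`. -/
abbrev coeffRing (K : Type*) [Field K] [Algebra K 𝓕] (s : SeedData 𝓕 n m) (k j : Fin n) :
    Subalgebra K 𝓕 :=
  laurentRing K (fun i : {i : Fin n ⊕ Fin m // i ≠ Sum.inl k ∧ i ≠ Sum.inl j} => s.x i)

theorem adjoin_inv_le_toSubalgebra {E : IntermediateField K 𝓕} {x : 𝓕} (hx : x ∈ E) :
    Algebra.adjoin K {x, x⁻¹} ≤ E.toSubalgebra :=
  adjoin_pair_le_iff.2 ⟨hx, IntermediateField.inv_mem _ hx⟩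

theorem coeffRing_le_adjoin (k j : Fin n) {l : Fin n} (hl : l = k ∨ l = j) :
    s.coeffRing K k j ≤ (IntermediateField.adjoin K (s.x '' {Sum.inl l}ᶜ)).toSubalgebra := by
  rw [laurentRing_le_iff]
  rintro ⟨i, hi⟩
  have : s.x i ∈ IntermediateField.adjoin K (s.x '' {Sum.inl l}ᶜ) := by
    refine IntermediateField.subset_adjoin _ _ ⟨i, ?_, rfl⟩
    rintro rfl
    rcases hl with rfl | rfl
    · exact hi.1 rfl
    · exact hi.2 rfl
  exact ⟨this, IntermediateField.inv_mem _ this⟩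

theorem laurentRing_eq (s : SeedData 𝓕 n m) (k j : Fin n) :
    laurentRing K s.x = s.coeffRing K k j ⊔
      Algebra.adjoin K {s.x (Sum.inl k), (s.x (Sum.inl k))⁻¹} ⊔
      Algebra.adjoin K {s.x (Sum.inl j), (s.x (Sum.inl j))⁻¹} :=
  laurentRing_eq_sup s.x (Sum.inl k) (Sum.inl j)

theorem coeffRing_mutate_left (s : SeedData 𝓕 n m) (k j : Fin n) :
    (s.mutate k).coeffRing K k j = s.coeffRing K k j := by
  unfold coeffRing
  congr 1
  funext i
  exact s.mutate_x_of_ne i.2.1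

theorem coeffRing_mutate_right (s : SeedData 𝓕 n m) (k j : Fin n) :
    (s.mutate j).coeffRing K k j = s.coeffRing K k j := by
  unfold coeffRing
  congr 1
  funext i
  exact s.mutate_x_of_ne i.2.2

theorem laurentRing_mutate_left (s : SeedData 𝓕 n m) {k j : Fin n} (hjk : j ≠ k) :
    laurentRing K (s.mutate k).x = s.coeffRing K k j ⊔
      Algebra.adjoin K {s.x' k, (s.x' k)⁻¹} ⊔
      Algebra.adjoin K {s.x (Sum.inl j), (s.x (Sum.inl j))⁻¹} := by
  rw [laurentRing_eq _ k j, coeffRing_mutate_left, mutate_x_self, mutate_x_of_ne _ (by simpa)]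

theorem laurentRing_mutate_right (s : SeedData 𝓕 n m) {k j : Fin n} (hjk : j ≠ k) :
    laurentRing K (s.mutate j).x = s.coeffRing K k j ⊔
      Algebra.adjoin K {s.x (Sum.inl k), (s.x (Sum.inl k))⁻¹} ⊔
      Algebra.adjoin K {s.x' j, (s.x' j)⁻¹} := by
  rw [laurentRing_eq _ k j, coeffRing_mutate_right, mutate_x_self,
    mutate_x_of_ne _ (by simpa using hjk.symm)]

theorem laurentRing_mutate_mutate (s : SeedData 𝓕 n m) {k j : Fin n} (hjk : j ≠ k) :
    laurentRing K ((s.mutate k).mutate j).x = s.coeffRing K k j ⊔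
      Algebra.adjoin K {s.x' k, (s.x' k)⁻¹} ⊔
      Algebra.adjoin K {(s.mutate k).x' j, ((s.mutate k).x' j)⁻¹} := by
  rw [laurentRing_mutate_right _ hjk, coeffRing_mutate_left, mutate_x_self]

/-- The exchange binomial with the powers of the variables `x k` and `x j` split off. -/
theorem exchange_eq {B : ExtMatrix n m} (x : Fin n ⊕ Fin m → 𝓕) {k j : Fin n} (hjk : j ≠ k)
    (c : Fin n) : B.exchange x c =
      (∏ i : {i : Fin n ⊕ Fin m // i ≠ Sum.inl k ∧ i ≠ Sum.inl j}, x i ^ (B i c).toNat) *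
        x (Sum.inl k) ^ (B (Sum.inl k) c).toNat * x (Sum.inl j) ^ (B (Sum.inl j) c).toNat +
      (∏ i : {i : Fin n ⊕ Fin m // i ≠ Sum.inl k ∧ i ≠ Sum.inl j}, x i ^ (-B i c).toNat) *
        x (Sum.inl k) ^ (-B (Sum.inl k) c).toNat * x (Sum.inl j) ^ (-B (Sum.inl j) c).toNat := by
  have hkj : (Sum.inl k : Fin n ⊕ Fin m) ≠ Sum.inl j := by simpa using hjk.symm
  rw [ExtMatrix.exchange, prod_eq_prod_subtype_mul_mul hkj, prod_eq_prod_subtype_mul_mul hkj]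

/-- The seed with the opposite matrix. It has the same exchange relations. -/
def neg (s : SeedData 𝓕 n m) : SeedData 𝓕 n m := ⟨s.x, -s.B⟩

theorem IsRegular.neg (hs : s.IsRegular K) : s.neg.IsRegular K where
  algebraicIndependent := hs.algebraicIndependent
  colInjective := hs.colInjective.neg
  isExchange := fun i j => by
    change -s.B _ _ = - -s.B _ _
    rw [hs.isExchange i j]

theorem neg_mutate (s : SeedData 𝓕 n m) (k : Fin n) : s.neg.mutate k = (s.mutate k).neg := by
  have hx : s.neg.x' k = s.x' k := by
    unfold x' neg
    rw [ExtMatrix.exchange_neg]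
  have h1 : (s.neg.mutate k).x = (s.mutate k).x := by
    rw [mutate_x, mutate_x, hx]; rfl
  have h2 : (s.neg.mutate k).B = -(s.mutate k).B := ExtMatrix.mutate_neg s.B k
  exact congrArg₂ SeedData.mk h1 h2

/-- The case of adjacent directions: the exchange relations have the shape required by
`mem_laurent_of_noncommuting`. -/
theorem mem_laurentRing_mutate_mutate_of_pos (hs : s.IsRegular K) {k j : Fin n} (hjk : j ≠ k)
    (hb : 0 < s.B (Sum.inl j) k) {z : 𝓕} (h0 : z ∈ laurentRing K s.x)
    (hk : z ∈ laurentRing K (s.mutate k).x) (hj : z ∈ laurentRing K (s.mutate j).x) :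
    z ∈ laurentRing K ((s.mutate k).mutate j).x := by
  obtain ⟨b, hb'⟩ := Int.eq_ofNat_of_zero_le hb.le
  have hb0 : b ≠ 0 := by rintro rfl; simp [hb'] at hb
  have hkj : (Sum.inl k : Fin n ⊕ Fin m) ≠ Sum.inl j := by simpa using hjk.symm
  have hBkj : s.B (Sum.inl k) j = -b := by rw [hs.isExchange k j, hb']
  have hjj := hs.isExchange.apply_self j
  have hkk := hs.isExchange.apply_self k
  have hs' := hs.mutate k
  have hex_k := exchange_eq (B := s.B) s.x hjk k
  have hex_j := exchange_eq (B := s.B) s.x hjk j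
  have hex_j' := exchange_eq (B := (s.mutate k).B) (s.mutate k).x hjk j
  have hB'kj : (s.mutate k).B (Sum.inl k) j = b := by
    change s.B.mutate k _ _ = _
    rw [ExtMatrix.mutate_apply_inl_self, hBkj, neg_neg]
  have hB' : ∀ i : {i : Fin n ⊕ Fin m // i ≠ Sum.inl k ∧ i ≠ Sum.inl j},
      (s.mutate k).B i j = s.B i j - b * (-s.B i k).toNat := by
    intro i
    change s.B.mutate k _ _ = _
    rw [ExtMatrix.mutate_apply_of_ne _ i.2.1 hjk, hBkj]
    have h1 : max (-(b : ℤ)) 0 = 0 := by omega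
    have h2 : min (-(b : ℤ)) 0 = -b := by omega
    have h3 : ((-s.B i k).toNat : ℤ) = -min (s.B i k) 0 := by omega
    rw [h1, h2, h3]; ring
  rw [hkk, hb'] at hex_k
  rw [hjj, hBkj] at hex_j
  rw [hs'.isExchange.apply_self j, hB'kj, mutate_x_self, mutate_x_of_ne _ hkj.symm] at hex_j'
  simp only [neg_zero, Int.toNat_zero, pow_zero, mul_one, Int.toNat_natCast,
    Int.toNat_neg_natCast, neg_neg] at hex_k hex_j hex_j'
  have hxi : ∀ i : {i : Fin n ⊕ Fin m // i ≠ Sum.inl k ∧ i ≠ Sum.inl j},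
      (s.mutate k).x i = s.x i := fun i => s.mutate_x_of_ne i.2.1
  simp only [hxi] at hex_j'
  set y : {i : Fin n ⊕ Fin m // i ≠ Sum.inl k ∧ i ≠ Sum.inl j} → 𝓕 := fun i => s.x i with hy
  have hmon0 : ∀ e : {i : Fin n ⊕ Fin m // i ≠ Sum.inl k ∧ i ≠ Sum.inl j} → ℕ,
      ∏ i, y i ^ e i ≠ 0 := fun e =>
    Finset.prod_ne_zero_iff.2 fun i _ => pow_ne_zero _ (hs.x_ne_zero _)
  rw [laurentRing_mutate_mutate s hjk]
  refine mem_laurent_of_noncommuting hb0 (hs.x_ne_zero (Sum.inl k)) (hs.x_ne_zero (Sum.inl j))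
    (hs.x'_ne_zero k) (hs'.x'_ne_zero j)
    (hmon0 fun i => (-s.B i k).toNat) (hmon0 fun i => (-(s.mutate k).B i j).toNat)
    (prod_mem_laurentRing y fun i => (s.B i k).toNat)
    (prod_mem_laurentRing y fun i => (-s.B i k).toNat)
    (prod_inv_mem_laurentRing y fun i => (-s.B i k).toNat)
    (prod_mem_laurentRing y fun i => (-s.B i j).toNat)
    (prod_mem_laurentRing y fun i => (-(s.mutate k).B i j).toNat)
    (prod_inv_mem_laurentRing y fun i => (-(s.mutate k).B i j).toNat)
    (prod_mem_laurentRing y fun i => ((s.mutate k).B i j).toNat)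
    ((hs.x_mul_x' k).trans hex_k) ((hs.x_mul_x' j).trans hex_j) ?_ ?_ ?_ ?_
    (M := ∏ i, y i ^ (s.B i j).toNat)
  · have h1 := hs'.x_mul_x' j
    rw [mutate_x_of_ne _ hkj.symm] at h1
    rw [h1, hex_j', add_comm]
  · rw [← Finset.prod_pow, ← Finset.prod_mul_distrib, ← Finset.prod_mul_distrib,
      ← Finset.prod_mul_distrib]
    refine Finset.prod_congr rfl fun i _ => ?_
    rw [← pow_mul, ← pow_add, ← pow_add, ← pow_add]
    congr 1
    have h1 := hB' i
    have h2 : ((-s.B i k).toNat * b : ℕ) = (b : ℤ) * (-s.B i k).toNat := by push_cast; ring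
    generalize (-s.B i k).toNat * b = w at *
    omega
  · refine mem_sup_pair_of_mem_laurent (hs.transcendental (Sum.inl j))
      (R := s.coeffRing K k j ⊔ Algebra.adjoin K {s.x (Sum.inl k), (s.x (Sum.inl k))⁻¹})
      (sup_le (coeffRing_le_adjoin (K := K) k j (Or.inr rfl)) ?_) ?_ (hs.x_mul_x' j)
      (hs.x'_ne_zero j)
      (laurentRing_eq (K := K) s k j ▸ h0) (laurentRing_mutate_right (K := K) s hjk ▸ hj)
    · have : s.x (Sum.inl k) ∈ IntermediateField.adjoin K (s.x '' {Sum.inl j}ᶜ) :=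
        IntermediateField.subset_adjoin _ _ ⟨_, hkj, rfl⟩
      exact adjoin_inv_le_toSubalgebra this
    · have hSle : s.coeffRing K k j ≤ s.coeffRing K k j ⊔
          Algebra.adjoin K {s.x (Sum.inl k), (s.x (Sum.inl k))⁻¹} := le_sup_left
      rw [hex_j]
      exact add_mem (hSle (prod_mem_laurentRing (K := K) y _))
        (mul_mem (hSle (prod_mem_laurentRing (K := K) y _)) (pow_mem
          ((le_sup_right : _ ≤ s.coeffRing K k j ⊔ _) (left_mem_adjoin_pair (K := K) _ _)) _))
  · exact laurentRing_mutate_left (K := K) s hjk ▸ hk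

/-- The case of non-adjacent directions, in which the two mutations commute. -/
theorem mem_laurentRing_mutate_mutate_of_eq_zero (hs : s.IsRegular K) {k j : Fin n} (hjk : j ≠ k)
    (hb : s.B (Sum.inl j) k = 0) {z : 𝓕} (h0 : z ∈ laurentRing K s.x)
    (hk : z ∈ laurentRing K (s.mutate k).x) (hj : z ∈ laurentRing K (s.mutate j).x) :
    z ∈ laurentRing K ((s.mutate k).mutate j).x := by
  have hkj : (Sum.inl k : Fin n ⊕ Fin m) ≠ Sum.inl j := by simpa using hjk.symm
  have hBkj : s.B (Sum.inl k) j = 0 := by rw [hs.isExchange k j, hb, neg_zero]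
  have hjj := hs.isExchange.apply_self j
  have hkk := hs.isExchange.apply_self k
  have hmem : ∀ c, s.B (Sum.inl k) c = 0 → s.B (Sum.inl j) c = 0 →
      s.B.exchange s.x c ∈ s.coeffRing K k j := by
    intro c h1 h2
    refine ExtMatrix.exchange_mem fun i hi => ?_
    refine mem_laurentRing (fun i : {i : Fin n ⊕ Fin m // i ≠ Sum.inl k ∧ i ≠ Sum.inl j} => s.x i)
      ⟨i, ?_, ?_⟩ <;> rintro rfl <;> contradiction
  have hPk := hmem k hkk hb
  have hPj := hmem j hBkj hjj
  have hx'j : (s.mutate k).x' j = s.x' j := by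
    unfold x'
    rw [mutate_x_of_ne _ hkj.symm]
    congr 1
    refine ExtMatrix.exchange_congr (fun i => ?_) fun i hi => s.mutate_x_of_ne ?_
    · change s.B.mutate k _ _ = _
      by_cases hi : i = Sum.inl k
      · subst hi; rw [ExtMatrix.mutate_apply_inl_self, hBkj, neg_zero]
      · rw [ExtMatrix.mutate_apply_of_ne _ hi hjk, hBkj]; simp
    · rintro rfl
      apply hi
      change s.B.mutate k _ _ = _
      rw [ExtMatrix.mutate_apply_inl_self, hBkj, neg_zero]
  have hxk : s.x (Sum.inl k) ∈ IntermediateField.adjoin K (s.x '' {Sum.inl j}ᶜ) :=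
    IntermediateField.subset_adjoin _ _ ⟨_, hkj, rfl⟩
  have hxj : s.x (Sum.inl j) ∈ IntermediateField.adjoin K (s.x '' {Sum.inl k}ᶜ) :=
    IntermediateField.subset_adjoin _ _ ⟨_, hkj.symm, rfl⟩
  have hSk := coeffRing_le_adjoin (K := K) (s := s) k j (Or.inl rfl)
  have hSj := coeffRing_le_adjoin (K := K) (s := s) k j (Or.inr rfl)
  have hSTj := sup_le hSj (adjoin_inv_le_toSubalgebra hxk)
  have hSTk := sup_le hSk (adjoin_inv_le_toSubalgebra hxj)
  have hz₁ : z ∈ s.coeffRing K k j ⊔ Algebra.adjoin K {s.x (Sum.inl j), (s.x (Sum.inl j))⁻¹} ⊔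
      Algebra.adjoin K {s.x (Sum.inl k), s.x' k} := by
    refine mem_sup_pair_of_mem_laurent (hs.transcendental (Sum.inl k)) hSTk
      ((le_sup_left : s.coeffRing K k j ≤ _) hPk) (hs.x_mul_x' k) (hs.x'_ne_zero k) ?_ ?_
    · rw [sup_right_comm]; exact laurentRing_eq (K := K) s k j ▸ h0
    · rw [sup_right_comm]; exact laurentRing_mutate_left (K := K) s hjk ▸ hk
  have hz₂ := mem_sup_pair_of_mem_laurent (hs.transcendental (Sum.inl j)) hSTj
      ((le_sup_left : s.coeffRing K k j ≤ _) hPj) (hs.x_mul_x' j) (hs.x'_ne_zero j)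
      (laurentRing_eq (K := K) s k j ▸ h0) (laurentRing_mutate_right (K := K) s hjk ▸ hj)
  rw [sup_right_comm] at hz₁
  have hz := mem_pair_pair_of_relPrime (hs.transcendental (Sum.inl k))
    (hs.transcendental (Sum.inl j)) hSk hSTj hPk hPj (hs.x_mul_x' k) (hs.x_mul_x' j)
    (fun a b f hf g hg h => hs.relPrime hjk hb a b hf hg h) hz₁ hz₂
  rw [laurentRing_mutate_mutate s hjk, hx'j]
  have haux : ∀ (c : Fin n) (A : Subalgebra K 𝓕), s.coeffRing K k j ≤ A →
      s.B.exchange s.x c ∈ s.coeffRing K k j → Algebra.adjoin K {s.x' c, (s.x' c)⁻¹} ≤ A →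
      Algebra.adjoin K {s.x (Sum.inl c), s.x' c} ≤ A := by
    intro c A hA hP h
    rw [adjoin_pair_le_iff] at h ⊢
    refine ⟨?_, h.1⟩
    have h1 : s.x (Sum.inl c) = s.B.exchange s.x c * (s.x' c)⁻¹ := by
      rw [← hs.x_mul_x' c, mul_assoc, mul_inv_cancel₀ (hs.x'_ne_zero c), mul_one]
    rw [h1]
    exact mul_mem (hA hP) h.2
  exact (sup_le (sup_le (le_sup_left.trans le_sup_left)
    (haux k _ (le_sup_left.trans le_sup_left) hPk (le_sup_right.trans le_sup_left)))
    (haux j _ (le_sup_left.trans le_sup_left) hPj le_sup_right)) hz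

/-- An element which is a Laurent polynomial in a cluster and in the clusters obtained by mutating
in directions `k` and `j` is one in the cluster obtained by mutating first in direction `k`, then in
direction `j`. -/
theorem mem_laurentRing_mutate_mutate (hs : s.IsRegular K) {k j : Fin n} (hjk : j ≠ k) {z : 𝓕}
    (h0 : z ∈ laurentRing K s.x) (hk : z ∈ laurentRing K (s.mutate k).x)
    (hj : z ∈ laurentRing K (s.mutate j).x) :
    z ∈ laurentRing K ((s.mutate k).mutate j).x := by
  rcases lt_trichotomy (s.B (Sum.inl j) k) 0 with hb | hb | hb
  · have h := mem_laurentRing_mutate_mutate_of_pos hs.neg hjk (z := z)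
      (by change 0 < -s.B _ _; omega) h0 (by rw [neg_mutate]; exact hk)
      (by rw [neg_mutate]; exact hj)
    rw [neg_mutate, neg_mutate] at h
    exact h
  · exact mem_laurentRing_mutate_mutate_of_eq_zero hs hjk hb h0 hk hj
  · exact mem_laurentRing_mutate_mutate_of_pos hs hjk hb h0 hk hj

/-- The upper bound of a seed: the elements which are Laurent polynomials in its cluster and in
the neighbouring clusters. -/
noncomputable def upperBound (K : Type*) [Field K] [Algebra K 𝓕] (s : SeedData 𝓕 n m) :
    Subalgebra K 𝓕 :=
  laurentRing K s.x ⊓ ⨅ k, laurentRing K (s.mutate k).x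

theorem mem_upperBound {z : 𝓕} : z ∈ s.upperBound K ↔
    z ∈ laurentRing K s.x ∧ ∀ k, z ∈ laurentRing K (s.mutate k).x := by
  simp [upperBound, Algebra.mem_inf, Algebra.mem_iInf]

theorem IsRegular.upperBound_le_mutate (hs : s.IsRegular K) (k : Fin n) :
    s.upperBound K ≤ (s.mutate k).upperBound K := by
  intro z hz
  rw [mem_upperBound] at hz ⊢
  refine ⟨hz.2 k, fun j => ?_⟩
  by_cases hjk : j = k
  · subst hjk; rw [hs.mutate_mutate]; exact hz.1
  · exact mem_laurentRing_mutate_mutate hs hjk hz.1 (hz.2 k) (hz.2 j)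

/-- The upper bound is the same for all seeds related by mutations. -/
theorem IsRegular.upperBound_eq_of_reaches (hs : s.IsRegular K) {t : SeedData 𝓕 n m}
    (hst : s.Reaches t) : s.upperBound K = t.upperBound K := by
  induction hst with
  | refl => rfl
  | @tail u t hu h ih =>
    obtain ⟨k, rfl⟩ := h
    have hur := hs.reaches hu
    refine ih.trans (le_antisymm (hur.upperBound_le_mutate k) ?_)
    have := (hur.mutate k).upperBound_le_mutate k
    rwa [hur.mutate_mutate k] at this

theorem IsRegular.x_mem_upperBound (hs : s.IsRegular K) (i) : s.x i ∈ s.upperBound K := by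
  rw [mem_upperBound]
  refine ⟨mem_laurentRing s.x i, fun k => ?_⟩
  by_cases hi : i = Sum.inl k
  · subst hi
    have h1 : s.x (Sum.inl k) = s.B.exchange s.x k * (s.x' k)⁻¹ := by
      rw [← hs.x_mul_x' k, mul_assoc, mul_inv_cancel₀ (hs.x'_ne_zero k), mul_one]
    rw [h1]
    refine mul_mem (ExtMatrix.exchange_mem fun i hi => ?_) ?_
    · rw [← s.mutate_x_of_ne (k := k) (i := i)]
      · exact mem_laurentRing _ i
      · rintro rfl; exact hi (hs.isExchange.apply_self k)
    · rw [← s.mutate_x_self]; exact inv_mem_laurentRing _ _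
  · rw [← s.mutate_x_of_ne hi]; exact mem_laurentRing _ i

theorem reaches_x_inr {t : SeedData 𝓕 n m} (hst : s.Reaches t) (j : Fin m) :
    t.x (Sum.inr j) = s.x (Sum.inr j) := by
  induction hst with
  | refl => rfl
  | tail _ h ih => obtain ⟨k, rfl⟩ := h; rw [mutate_x_of_ne _ (by simp), ih]

/-- The Laurent phenomenon: the cluster algebra is contained in the Laurent ring of every seed. -/
theorem IsRegular.clusterAlgebra_le_laurentRing (hs : s.IsRegular K) {t : SeedData 𝓕 n m}
    (hst : s.Reaches t) : s.clusterAlgebra K ≤ laurentRing K t.x := by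
  refine Algebra.adjoin_le ?_
  rintro z (⟨u, hu, i, rfl⟩ | ⟨j, rfl⟩)
  · have h := (hs.reaches hu).x_mem_upperBound i
    rw [← hs.upperBound_eq_of_reaches hu, hs.upperBound_eq_of_reaches hst, mem_upperBound] at h
    exact h.1
  · change (s.x (Sum.inr j))⁻¹ ∈ laurentRing K t.x
    rw [← reaches_x_inr hst j]
    exact inv_mem_laurentRing _ _

end SeedData

end ClusterVariety

/-! ### Points of the cluster variety of an acyclic seed -/

namespace ClusterVariety

namespace ExtMatrix

variable {n m : ℕ}

/-- The solutions of the exchange relations over `K`: values `a` of the cluster variables, nonzero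
on the frozen ones, and values `a'` of the adjacent cluster variables. -/
abbrev Solution (B : ExtMatrix n m) (K : Type*) [Field K] : Type _ :=
  {p : (Fin n ⊕ Fin m → K) × (Fin n → K) //
    (∀ j, p.1 (Sum.inr j) ≠ 0) ∧ ∀ l, p.1 (Sum.inl l) * p.2 l = B.exchange p.1 l}

/-- If one of the two monomials of a vanishing exchange binomial vanishes, then so does the other.
Hence a vanishing neighbour can be replaced by one along an outgoing edge. -/
theorem exists_edge_of_exchange_eq_zero {K : Type*} [Field K] {B : ExtMatrix n m}
    (hex : B.IsExchange) {a : Fin n ⊕ Fin m → K} (ha : ∀ j, a (Sum.inr j) ≠ 0) {i w : Fin n}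
    (hi : B.exchange a i = 0) (hw : a (Sum.inl w) = 0) (hiw : B (Sum.inl i) w ≠ 0) :
    ∃ l, a (Sum.inl l) = 0 ∧ 0 < B (Sum.inl i) l := by
  rcases lt_or_gt_of_ne hiw with h | h
  · have h1 : ∏ r, a r ^ (B r i).toNat = 0 := by
      refine Finset.prod_eq_zero (Finset.mem_univ (Sum.inl w)) ?_
      rw [hw, zero_pow]
      have := hex w i
      omega
    rw [exchange, h1, zero_add, Finset.prod_eq_zero_iff] at hi
    obtain ⟨r, -, hr⟩ := hi
    rw [pow_eq_zero_iff'] at hr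
    rcases r with l | j
    · have := hex l i
      exact ⟨l, hr.1, by omega⟩
    · exact absurd hr.1 (ha j)
  · exact ⟨w, hw, h⟩

/-- In the acyclic case, the vertices where a solution of the exchange relations vanishes are
pairwise non-adjacent: otherwise one could walk forever along edges inside the vanishing locus. -/
theorem IsAcyclic.eq_zero_of_solution {K : Type*} [Field K] {B : ExtMatrix n m} (hB : B.IsAcyclic)
    (hex : B.IsExchange) (p : B.Solution K) {i w : Fin n} (hi : p.1.1 (Sum.inl i) = 0)
    (hw : p.1.1 (Sum.inl w) = 0) : B (Sum.inl i) w = 0 := by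
  by_contra hiw
  have htrans : IsTrans (Fin n) (fun x y => Relation.TransGen B.Edge y x) :=
    ⟨fun a b c hab hbc => hbc.trans hab⟩
  have hirr : Std.Irrefl (fun x y : Fin n => Relation.TransGen B.Edge y x) := ⟨hB⟩
  have hwf : WellFounded (fun x y : Fin n => Relation.TransGen B.Edge y x) :=
    Finite.wellFounded_of_trans_of_irrefl _
  obtain ⟨u, ⟨hu0, v, hv0, huv⟩, hmin⟩ := hwf.has_min
    {u | p.1.1 (Sum.inl u) = 0 ∧ ∃ v, p.1.1 (Sum.inl v) = 0 ∧ B (Sum.inl u) v ≠ 0}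
    ⟨i, hi, w, hw, hiw⟩
  obtain ⟨l, hl0, hul⟩ := exists_edge_of_exchange_eq_zero hex p.2.1
    (by rw [← p.2.2 u, hu0, zero_mul]) hv0 huv
  refine hmin l ⟨hl0, u, hu0, ?_⟩ (Relation.TransGen.single hul)
  have := hex l u
  omega

/-- There are no edges between the vertices in `I`. -/
def IsIndep (B : ExtMatrix n m) (I : Finset (Fin n)) : Prop :=
  ∀ i ∈ I, ∀ l ∈ I, B (Sum.inl i) l = 0

theorem mem_anticliques {B : ExtMatrix n m} (hex : B.IsExchange) {k : ℕ} {I : Finset (Fin n)} :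
    I ∈ B.anticliques k ↔ I.card = k ∧ B.IsIndep I := by
  classical
  simp only [anticliques, Finset.mem_filter, Finset.mem_univ, true_and,
    SimpleGraph.isNIndepSet_iff, SimpleGraph.IsIndepSet, Set.Pairwise, graph,
    SimpleGraph.fromRel_adj, Edge, IsIndep]
  rw [and_comm]
  refine and_congr_right fun _ => ⟨fun h i hi l hl => ?_, fun h i hi l hl hil => ?_⟩
  · by_cases hil : i = l
    · subst hil; exact hex.apply_self i
    · have h1 := h hi hl hil
      have h2 := hex i l
      by_contra h3
      apply h1
      refine ⟨hil, ?_⟩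
      omega
  · have h1 := h i hi l hl
    have h2 := h l hl i hi
    omega

end ExtMatrix

theorem exists_field_extension.{v} {K : Type*} [Field K] (D : Type v) [CommRing D] [IsDomain D]
    [Algebra K D] : ∃ (L : Type v) (_ : Field L) (_ : Algebra K L) (ι : D →ₐ[K] L),
      Function.Injective ι :=
  ⟨FractionRing D, inferInstance, inferInstance, IsScalarTower.toAlgHom K _ _,
    IsFractionRing.injective D (FractionRing D)⟩

theorem exists_algHom_lift {K A D L : Type*} [CommRing K] [CommRing A] [Algebra K A] [CommRing D]
    [Algebra K D] [CommRing L] [Algebra K L] (ψ : A →ₐ[K] L) {ι : D →ₐ[K] L}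
    (hι : Function.Injective ι) (h : ∀ z, ψ z ∈ ι.range) : ∃ θ : A →ₐ[K] D, ∀ z, ι (θ z) = ψ z := by
  refine ⟨(AlgEquiv.ofInjective ι hι).symm.toAlgHom.comp (ψ.codRestrict ι.range h), fun z => ?_⟩
  exact congrArg Subtype.val ((AlgEquiv.ofInjective ι hι).apply_symm_apply
    (ψ.codRestrict ι.range h z))

namespace SeedData

variable {K 𝓕 : Type*} [Field K] [Field 𝓕] [Algebra K 𝓕] {n m : ℕ} {s t : SeedData 𝓕 n m}

/-- The cluster of `t` with `x l` replaced by `x' l` for `l ∈ H`. -/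
noncomputable def flip (t : SeedData 𝓕 n m) (H : Finset (Fin n)) : Fin n ⊕ Fin m → 𝓕
  | Sum.inl l => if l ∈ H then t.x' l else t.x (Sum.inl l)
  | Sum.inr j => t.x (Sum.inr j)

theorem flip_of_mem {H : Finset (Fin n)} {l : Fin n} (hl : l ∈ H) :
    t.flip H (Sum.inl l) = t.x' l := if_pos hl

theorem flip_of_notMem {H : Finset (Fin n)} {i : Fin n ⊕ Fin m} (hi : ∀ l ∈ H, i ≠ Sum.inl l) :
    t.flip H i = t.x i := by
  rcases i with l | j
  · exact if_neg fun hl => hi l hl rfl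
  · rfl

/-- Mutations in pairwise non-adjacent directions do not interact: mutating at all vertices of
a subset `H` of an independent set replaces each `x l`, `l ∈ H`, by `x' l`. -/
theorem exists_reaches_flip {I : Finset (Fin n)} (hI : t.B.IsIndep I) (H : Finset (Fin n))
    (hH : H ⊆ I) : ∃ u : SeedData 𝓕 n m, t.Reaches u ∧ u.x = t.flip H ∧
      ∀ l ∈ I, l ∉ H → ∀ i, u.B i l = t.B i l := by
  induction H using Finset.induction_on with
  | empty => exact ⟨t, .refl, funext fun i => (flip_of_notMem (by simp)).symm, by simp⟩
  | insert l H hl ih =>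
    obtain ⟨u, htu, hux, huB⟩ := ih ((Finset.subset_insert l H).trans hH)
    have hlI : l ∈ I := hH (Finset.mem_insert_self l H)
    have hlx : u.x (Sum.inl l) = t.x (Sum.inl l) := by
      rw [hux]
      refine flip_of_notMem ?_
      rintro r hr h
      obtain rfl : l = r := Sum.inl_injective h
      exact hl hr
    have hx' : u.x' l = t.x' l := by
      unfold x'
      rw [hlx]
      congr 1
      refine ExtMatrix.exchange_congr (fun i => huB l hlI hl i) fun i hi => ?_
      rw [hux]
      refine flip_of_notMem ?_
      rintro r hr rfl
      apply hi
      rw [huB l hlI hl]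
      exact hI r (hH (Finset.mem_insert_of_mem hr)) l hlI
    refine ⟨u.mutate l, htu.tail ⟨l, rfl⟩, ?_, ?_⟩
    · funext i
      by_cases hi : i = Sum.inl l
      · subst hi
        rw [mutate_x_self, hx', flip_of_mem (Finset.mem_insert_self l H)]
      · rw [mutate_x_of_ne _ hi, hux]
        rcases i with r | j
        · have hr : r ≠ l := fun h => hi (congrArg _ h)
          simp [flip, hr]
        · rfl
    · intro r hr hrH i
      rw [Finset.mem_insert, not_or] at hrH
      change u.B.mutate l i r = _
      have h0 : u.B (Sum.inl l) r = 0 := by rw [huB r hr hrH.2]; exact hI l hlI r hr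
      by_cases hi : i = Sum.inl l
      · subst hi
        rw [ExtMatrix.mutate_apply_inl_self, h0, neg_zero]
        exact (hI l hlI r hr).symm
      · rw [ExtMatrix.mutate_apply_of_ne _ hi hrH.1, h0, huB r hr hrH.2]
        simp

/-- The factor in direction `i` of the mixed ring: `K[x l, x' l]` for `l ∈ J`,
`K[x' l, (x' l)⁻¹]` for `l ∈ H`, and `K[x i, (x i)⁻¹]` in the other directions. -/
noncomputable def piece (K : Type*) [Field K] [Algebra K 𝓕] (t : SeedData 𝓕 n m)
    (J H : Finset (Fin n)) : Fin n ⊕ Fin m → Subalgebra K 𝓕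
  | Sum.inl l => if l ∈ J then Algebra.adjoin K {t.x (Sum.inl l), t.x' l} else
      Algebra.adjoin K {t.flip H (Sum.inl l), (t.flip H (Sum.inl l))⁻¹}
  | Sum.inr j => Algebra.adjoin K {t.x (Sum.inr j), (t.x (Sum.inr j))⁻¹}

theorem piece_of_mem {J H : Finset (Fin n)} {l : Fin n} (hl : l ∈ J) :
    t.piece K J H (Sum.inl l) = Algebra.adjoin K {t.x (Sum.inl l), t.x' l} := if_pos hl

theorem piece_of_notMem {J H : Finset (Fin n)} {i : Fin n ⊕ Fin m} (hi : ∀ l ∈ J, i ≠ Sum.inl l) :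
    t.piece K J H i = Algebra.adjoin K {t.flip H i, (t.flip H i)⁻¹} := by
  rcases i with l | j
  · exact if_neg fun hl => hi l hl rfl
  · rfl

theorem piece_congr {J J' H H' : Finset (Fin n)} {i : Fin n ⊕ Fin m}
    (hi : ∀ l, i = Sum.inl l → (l ∈ J ↔ l ∈ J') ∧ (l ∈ H ↔ l ∈ H')) :
    t.piece K J H i = t.piece K J' H' i := by
  rcases i with l | j
  · simp only [piece, flip, hi l rfl]
  · rfl

/-- For an independent set `I`, intersecting the Laurent rings of the seeds obtained by mutating
at the subsets of `I` leaves the ring generated by `x l`, `x' l` for `l ∈ I` and `x i`, `(x i)⁻¹`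
in the other directions. -/
theorem IsRegular.clusterAlgebra_le_iSup_piece (hs : s.IsRegular K) (hst : s.Reaches t)
    {I : Finset (Fin n)} (hI : t.B.IsIndep I) (J H : Finset (Fin n)) (hJ : J ⊆ I) (hH : H ⊆ I)
    (hJH : Disjoint J H) : s.clusterAlgebra K ≤ ⨆ i, t.piece K J H i := by
  have ht := hs.reaches hst
  induction J using Finset.induction_on generalizing H with
  | empty =>
    obtain ⟨u, htu, hux, -⟩ := exists_reaches_flip hI H hH
    have h := hs.clusterAlgebra_le_laurentRing (hst.trans htu)
    rw [hux] at h
    refine h.trans (iSup_mono fun i => ?_)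
    rw [piece_of_notMem (by simp)]
  | insert l J hl ih =>
    have hlI : l ∈ I := hJ (Finset.mem_insert_self l J)
    have hJI : J ⊆ I := (Finset.subset_insert l J).trans hJ
    rw [Finset.disjoint_insert_left] at hJH
    intro z hz
    have h1 := ih H hJI hH hJH.2 hz
    have h2 := ih (insert l H) hJI (Finset.insert_subset hlI hH)
      (Finset.disjoint_insert_right.2 ⟨hl, hJH.2⟩) hz
    set R : Subalgebra K 𝓕 := ⨆ (i) (_ : i ≠ Sum.inl l), t.piece K J H i with hRdef
    have hR2 : (⨆ (i) (_ : i ≠ Sum.inl l), t.piece K J (insert l H) i) = R := by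
      refine iSup_congr fun i => iSup_congr fun hi => piece_congr fun r hr => ⟨Iff.rfl, ?_⟩
      have : r ≠ l := by rintro rfl; exact hi hr
      simp [this]
    have hR3 : (⨆ (i) (_ : i ≠ Sum.inl l), t.piece K (insert l J) H i) = R := by
      refine iSup_congr fun i => iSup_congr fun hi => piece_congr fun r hr => ⟨?_, Iff.rfl⟩
      have : r ≠ l := by rintro rfl; exact hi hr
      simp [this]
    have hne : ∀ r ∈ J, (Sum.inl l : Fin n ⊕ Fin m) ≠ Sum.inl r := by
      rintro r hr h
      obtain rfl : l = r := Sum.inl_injective h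
      exact hl hr
    have hneH : ∀ r ∈ H, (Sum.inl l : Fin n ⊕ Fin m) ≠ Sum.inl r := by
      rintro r hr h
      obtain rfl : l = r := Sum.inl_injective h
      exact hJH.1 hr
    rw [iSup_split_single _ (Sum.inl l), sup_comm] at h1 h2 ⊢
    rw [hR2, piece_of_notMem hne, flip_of_mem (Finset.mem_insert_self l H)] at h2
    rw [piece_of_notMem hne, flip_of_notMem hneH] at h1
    rw [hR3, piece_of_mem (Finset.mem_insert_self l J)]
    refine mem_sup_pair_of_mem_laurent (ht.transcendental (Sum.inl l)) ?_ ?_ (ht.x_mul_x' l)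
      (ht.x'_ne_zero l) h1 h2
    · -- none of the generators of `R` involves `x l`
      refine iSup₂_le fun i hi => ?_
      have hx : ∀ r : Fin n ⊕ Fin m, r ≠ Sum.inl l →
          t.x r ∈ IntermediateField.adjoin K (t.x '' {Sum.inl l}ᶜ) :=
        fun r hr => IntermediateField.subset_adjoin _ _ ⟨r, hr, rfl⟩
      have hx' : ∀ r ∈ I, r ≠ l → t.x' r ∈ IntermediateField.adjoin K (t.x '' {Sum.inl l}ᶜ) := by
        intro r hr hrl
        refine div_mem (ExtMatrix.exchange_mem fun i hi => hx i ?_) (hx _ (by simpa))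
        rintro rfl
        exact hi (hI l hlI r hr)
      rcases i with r | j
      · have hrl : r ≠ l := fun h => hi (congrArg _ h)
        simp only [piece, flip]
        split_ifs with hrJ hrH
        · exact adjoin_pair_le_iff.2 ⟨hx _ hi, hx' r (hJI hrJ) hrl⟩
        · exact adjoin_inv_le_toSubalgebra (hx' r (hH hrH) hrl)
        · exact adjoin_inv_le_toSubalgebra (hx _ hi)
      · exact adjoin_inv_le_toSubalgebra (hx _ hi)
    · refine ExtMatrix.exchange_mem fun i hi => ?_
      have hiI : ∀ r ∈ I, i ≠ Sum.inl r := by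
        rintro r hr rfl; exact hi (hI r hr l hlI)
      have h3 : t.piece K J H i ≤ R := le_iSup₂_of_le i (hiI l hlI) le_rfl
      apply h3
      rw [piece_of_notMem fun r hr => hiI r (hJI hr), flip_of_notMem fun r hr => hiI r (hH hr)]
      exact left_mem_adjoin_pair _ _

theorem Reaches.x_mem_clusterAlgebra (hst : s.Reaches t) (i) : t.x i ∈ s.clusterAlgebra K :=
  Algebra.subset_adjoin (Or.inl ⟨t, hst, i, rfl⟩)

theorem Reaches.x'_mem_clusterAlgebra (hst : s.Reaches t) (l : Fin n) :
    t.x' l ∈ s.clusterAlgebra K := by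
  rw [← mutate_x_self]
  exact Reaches.x_mem_clusterAlgebra (hst.tail ⟨l, rfl⟩) _

theorem Reaches.inv_mem_clusterAlgebra (hst : s.Reaches t) (j : Fin m) :
    (t.x (Sum.inr j))⁻¹ ∈ s.clusterAlgebra K := by
  rw [reaches_x_inr hst]
  exact Algebra.subset_adjoin (Or.inr ⟨j, rfl⟩)

/-- The solution of the exchange relations of `t` given by a point. -/
noncomputable def pointToSolution (hs : s.IsRegular K) (hst : s.Reaches t) (f : s.points K) :
    t.B.Solution K :=
  ⟨(fun i => f ⟨t.x i, hst.x_mem_clusterAlgebra i⟩,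
    fun l => f ⟨t.x' l, hst.x'_mem_clusterAlgebra l⟩), by
    constructor
    · intro j
      have h : (⟨t.x (Sum.inr j), hst.x_mem_clusterAlgebra _⟩ : s.clusterAlgebra K) *
          ⟨(t.x (Sum.inr j))⁻¹, hst.inv_mem_clusterAlgebra j⟩ = 1 :=
        Subtype.ext (mul_inv_cancel₀ ((hs.reaches hst).x_ne_zero _))
      have h1 := congrArg f h
      rw [map_mul, map_one] at h1
      exact left_ne_zero_of_mul_eq_one h1
    · intro l
      dsimp only
      rw [← map_mul, ← ExtMatrix.map_exchange]
      congr 1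
      apply Subtype.ext
      refine ((hs.reaches hst).x_mul_x' l).trans ?_
      exact (ExtMatrix.map_exchange t.B (s.clusterAlgebra K).val
        (fun i => ⟨t.x i, hst.x_mem_clusterAlgebra i⟩) l).symm⟩

/-- A point is determined by its solution, since the cluster algebra is contained in a ring of
fractions in the variables `x i`, `x' l` whose denominators do not vanish at the point. -/
theorem pointToSolution_injective (hs : s.IsRegular K) (hst : s.Reaches t)
    (hac : t.B.IsAcyclic) : Function.Injective (pointToSolution (K := K) hs hst) := by
  classical
  intro f g hfg
  have ht := hs.reaches hst
  have hx : ∀ i, f ⟨t.x i, hst.x_mem_clusterAlgebra i⟩ = g ⟨t.x i, hst.x_mem_clusterAlgebra i⟩ :=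
    fun i => congrFun (congrArg (fun p => p.1.1) hfg) i
  have hx' : ∀ l, f ⟨t.x' l, hst.x'_mem_clusterAlgebra l⟩ =
      g ⟨t.x' l, hst.x'_mem_clusterAlgebra l⟩ :=
    fun l => congrFun (congrArg (fun p => p.1.2) hfg) l
  let I : Finset (Fin n) :=
    Finset.univ.filter fun l => f ⟨t.x (Sum.inl l), hst.x_mem_clusterAlgebra _⟩ = 0
  have hI : t.B.IsIndep I := by
    intro i hi l hl
    exact hac.eq_zero_of_solution ht.isExchange (pointToSolution hs hst f)
      (Finset.mem_filter.1 hi).2 (Finset.mem_filter.1 hl).2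
  have hA := hs.clusterAlgebra_le_iSup_piece hst hI I ∅ subset_rfl (by simp) (by simp)
  -- the points agree on `D`, and the denominators in `M` are elements of `D` at which they do not
  -- vanish
  let D : Subalgebra K 𝓕 := (AlgHom.equalizer f g).map (s.clusterAlgebra K).val
  let M : Submonoid 𝓕 :=
    { carrier := {w | ∃ h : w ∈ s.clusterAlgebra K, f ⟨w, h⟩ = g ⟨w, h⟩ ∧ f ⟨w, h⟩ ≠ 0}
      one_mem' := ⟨one_mem _, by
        have : (⟨1, one_mem _⟩ : s.clusterAlgebra K) = 1 := rfl
        rw [this, map_one, map_one]; exact ⟨rfl, one_ne_zero⟩⟩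
      mul_mem' := by
        rintro a b ⟨ha, h1, h2⟩ ⟨hb, h3, h4⟩
        refine ⟨mul_mem ha hb, ?_⟩
        have : (⟨a * b, mul_mem ha hb⟩ : s.clusterAlgebra K) = ⟨a, ha⟩ * ⟨b, hb⟩ := rfl
        rw [this, map_mul, map_mul, h1, h3]
        exact ⟨rfl, mul_ne_zero (h1 ▸ h2) (h3 ▸ h4)⟩ }
  have hD : ∀ w (h : w ∈ s.clusterAlgebra K), f ⟨w, h⟩ = g ⟨w, h⟩ → w ∈ D :=
    fun w h e => ⟨⟨w, h⟩, e, rfl⟩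
  have hMD : ∀ w ∈ M, w ∈ D := fun w ⟨h, e, _⟩ => hD w h e
  have hle : (⨆ i, t.piece K I ∅ i) ≤ fracAlg D M hMD := by
    refine iSup_le fun i => ?_
    by_cases hi : ∃ l ∈ I, i = Sum.inl l
    · obtain ⟨l, hl, rfl⟩ := hi
      rw [piece_of_mem hl]
      exact adjoin_pair_le_iff.2 ⟨le_fracAlg (hD _ _ (hx _)), le_fracAlg (hD _ _ (hx' l))⟩
    · push Not at hi
      rw [piece_of_notMem hi, flip_of_notMem (by simp)]
      refine adjoin_pair_le_iff.2 ⟨le_fracAlg (hD _ _ (hx i)),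
        inv_mem_fracAlg ⟨hst.x_mem_clusterAlgebra i, hx i, ?_⟩ (ht.x_ne_zero i)⟩
      rcases i with l | j
      · intro h0
        exact hi l (Finset.mem_filter.2 ⟨Finset.mem_univ _, h0⟩) rfl
      · exact (pointToSolution hs hst f).2.1 j
  refine AlgHom.ext fun z => ?_
  obtain ⟨w, ⟨hw, h1, h2⟩, ⟨⟨v, hv⟩, h3, h4⟩⟩ := hle (hA z.2)
  have h5 : (⟨v, hv⟩ : s.clusterAlgebra K) = ⟨w, hw⟩ * z := Subtype.ext h4
  have h6 : f ⟨v, hv⟩ = g ⟨v, hv⟩ := h3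
  rw [h5, map_mul, map_mul, ← h1] at h6
  exact mul_left_cancel₀ h2 h6

/-- On the cluster mutated at the vanishing locus `I` of a solution, send `x' l` for `l ∈ I` to an
indeterminate and all other variables to their values. The cluster algebra is then mapped to
polynomials in these indeterminates. -/
theorem exists_algHom_mvPolynomial (hs : s.IsRegular K) (hst : s.Reaches t) (p : t.B.Solution K)
    {I : Finset (Fin n)} (hmemI : ∀ l, l ∈ I ↔ p.1.1 (Sum.inl l) = 0) (hI : t.B.IsIndep I) :
    ∃ θ : s.clusterAlgebra K →ₐ[K] MvPolynomial (Fin n) K,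
      (∀ i, (∀ l ∈ I, i ≠ Sum.inl l) →
        θ ⟨t.x i, hst.x_mem_clusterAlgebra i⟩ = MvPolynomial.C (p.1.1 i)) ∧
      ∀ l ∈ I, θ ⟨t.x (Sum.inl l), hst.x_mem_clusterAlgebra _⟩ = 0 ∧
        θ ⟨t.x' l, hst.x'_mem_clusterAlgebra l⟩ = MvPolynomial.X l := by
  classical
  have ht := hs.reaches hst
  have hA := hs.clusterAlgebra_le_iSup_piece hst hI I ∅ subset_rfl (by simp) (by simp)
  obtain ⟨u, htu, hux, -⟩ := exists_reaches_flip hI I subset_rfl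
  have hAu := hs.clusterAlgebra_le_laurentRing (hst.trans htu)
  have hu := hs.reaches (hst.trans htu)
  have hp0 : ∀ i, (∀ l ∈ I, i ≠ Sum.inl l) → p.1.1 i ≠ 0 := by
    rintro (l | j) hi
    · exact fun h => hi l ((hmemI l).2 h) rfl
    · exact p.2.1 j
  -- the values must be units, so they are taken in a field containing the polynomial ring
  obtain ⟨Fr, _, _, ι, hι⟩ := exists_field_extension (K := K) (MvPolynomial (Fin n) K)
  let c : Fin n ⊕ Fin m → MvPolynomial (Fin n) K := fun i =>
    if h : ∃ l ∈ I, i = Sum.inl l then MvPolynomial.X h.choose else MvPolynomial.C (p.1.1 i)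
  have hc1 : ∀ l ∈ I, c (Sum.inl l) = MvPolynomial.X l := by
    intro l hl
    have h : ∃ r ∈ I, (Sum.inl l : Fin n ⊕ Fin m) = Sum.inl r := ⟨l, hl, rfl⟩
    simp only [c, dif_pos h]
    rw [Sum.inl_injective h.choose_spec.2.symm]
  have hc2 : ∀ i, (∀ l ∈ I, i ≠ Sum.inl l) → c i = MvPolynomial.C (p.1.1 i) := by
    intro i hi
    have h : ¬ ∃ l ∈ I, i = Sum.inl l := by push Not; exact hi
    simp only [c, dif_neg h]
  have hc0 : ∀ i, ι (c i) ≠ 0 := by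
    intro i
    rw [(map_ne_zero_iff ι hι)]
    by_cases hi : ∃ l ∈ I, i = Sum.inl l
    · obtain ⟨l, hl, rfl⟩ := hi
      rw [hc1 l hl]; exact MvPolynomial.X_ne_zero l
    · push Not at hi
      rw [hc2 i hi, Ne, MvPolynomial.C_eq_zero]; exact hp0 i hi
  obtain ⟨φ, hφ⟩ := exists_algHom_laurentRing hu.algebraicIndependent
    (fun i => Units.mk0 (ι (c i)) (hc0 i))
  have hφx : ∀ i (h : t.x i ∈ laurentRing K u.x), (∀ l ∈ I, i ≠ Sum.inl l) →
      φ ⟨t.x i, h⟩ = ι (MvPolynomial.C (p.1.1 i)) := by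
    intro i h hi
    have h1 := hφ i
    rw [Units.val_mk0, hc2 i hi] at h1
    rw [← h1]
    congr 1
    exact Subtype.ext ((flip_of_notMem hi).symm.trans (congrFun hux i).symm)
  have hφx' : ∀ l (h : t.x' l ∈ laurentRing K u.x), l ∈ I →
      φ ⟨t.x' l, h⟩ = ι (MvPolynomial.X l) := by
    intro l h hl
    have h1 := hφ (Sum.inl l)
    rw [Units.val_mk0, hc1 l hl] at h1
    rw [← h1]
    congr 1
    exact Subtype.ext ((flip_of_mem hl).symm.trans (congrFun hux _).symm)
  have hmemx : ∀ i, t.x i ∈ laurentRing K u.x := fun i => hAu (hst.x_mem_clusterAlgebra i)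
  have hmemx' : ∀ l, t.x' l ∈ laurentRing K u.x := fun l => hAu (hst.x'_mem_clusterAlgebra l)
  have hφ0 : ∀ l ∈ I, φ ⟨t.x (Sum.inl l), hmemx _⟩ = 0 := by
    intro l hl
    have h1 : (⟨t.x (Sum.inl l), hmemx _⟩ : laurentRing K u.x) * ⟨t.x' l, hmemx' l⟩ =
        t.B.exchange (fun i => ⟨t.x i, hmemx i⟩) l := by
      apply Subtype.ext
      refine (ht.x_mul_x' l).trans ?_
      exact (ExtMatrix.map_exchange t.B (laurentRing K u.x).val (fun i => ⟨t.x i, hmemx i⟩) l).symm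
    have h2 := congrArg φ h1
    rw [map_mul, ExtMatrix.map_exchange, hφx' l _ hl] at h2
    have h3 : t.B.exchange (fun i => φ ⟨t.x i, hmemx i⟩) l =
        t.B.exchange (fun i => (ι.comp (Algebra.ofId K _)) (p.1.1 i)) l :=
      ExtMatrix.exchange_congr (fun _ => rfl) fun i hi => hφx i _ (by
        rintro r hr rfl; exact hi (hI r hr l hl))
    rw [h3, ← ExtMatrix.map_exchange, ← p.2.2 l, (hmemI l).1 hl, zero_mul, map_zero] at h2
    exact (mul_eq_zero.1 h2).resolve_right
      ((map_ne_zero_iff ι hι).2 (MvPolynomial.X_ne_zero l))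
  have hrange : (⨆ i, t.piece K I ∅ i) ≤ (ι.range.comap φ).map (laurentRing K u.x).val := by
    refine iSup_le fun i => ?_
    by_cases hi : ∃ l ∈ I, i = Sum.inl l
    · obtain ⟨l, hl, rfl⟩ := hi
      rw [piece_of_mem hl]
      refine adjoin_pair_le_iff.2 ⟨⟨⟨_, hmemx _⟩, ?_, rfl⟩, ⟨⟨_, hmemx' l⟩, ?_, rfl⟩⟩
      · exact ⟨0, (map_zero ι).trans (hφ0 l hl).symm⟩
      · exact ⟨_, (hφx' l _ hl).symm⟩
    · push Not at hi
      rw [piece_of_notMem hi, flip_of_notMem (by simp)]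
      have hinv : (t.x i)⁻¹ ∈ laurentRing K u.x := by
        have := inv_mem_laurentRing (K := K) u.x i
        rwa [hux, flip_of_notMem hi, ← hux] at this
      refine adjoin_pair_le_iff.2 ⟨⟨⟨_, hmemx _⟩, ?_, rfl⟩, ⟨⟨_, hinv⟩, ?_, rfl⟩⟩
      · exact ⟨_, (hφx i _ hi).symm⟩
      · refine ⟨MvPolynomial.C (p.1.1 i)⁻¹, ?_⟩
        have h1 : (⟨t.x i, hmemx i⟩ : laurentRing K u.x) * ⟨(t.x i)⁻¹, hinv⟩ = 1 :=
          Subtype.ext (mul_inv_cancel₀ (ht.x_ne_zero i))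
        have h2 := congrArg φ h1
        rw [map_mul, map_one, hφx i _ hi] at h2
        have h3 : ι (MvPolynomial.C (p.1.1 i)) * ι (MvPolynomial.C (p.1.1 i)⁻¹) = 1 := by
          rw [← map_mul, ← MvPolynomial.C_mul, mul_inv_cancel₀ (hp0 i hi), MvPolynomial.C_1,
            map_one]
        exact mul_left_cancel₀ (left_ne_zero_of_mul_eq_one h3) (h3.trans h2.symm)
  obtain ⟨θ, hθ⟩ := exists_algHom_lift (φ.comp (Subalgebra.inclusion hAu)) hι (by
    intro z
    obtain ⟨w, hw, hwz⟩ := hrange (hA z.2)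
    have h1 : Subalgebra.inclusion hAu z = w := Subtype.ext hwz.symm
    rw [AlgHom.comp_apply, h1]
    exact hw)
  refine ⟨θ, fun i hi => hι ?_, fun l hl => ⟨hι ?_, hι ?_⟩⟩
  · rw [hθ]; exact hφx i _ hi
  · rw [hθ, map_zero]; exact hφ0 l hl
  · rw [hθ]; exact hφx' l _ hl

/-- Every solution is a point: specialize the indeterminates. -/
theorem pointToSolution_surjective (hs : s.IsRegular K) (hst : s.Reaches t)
    (hac : t.B.IsAcyclic) : Function.Surjective (pointToSolution (K := K) hs hst) := by
  classical
  intro p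
  have ht := hs.reaches hst
  let I : Finset (Fin n) := Finset.univ.filter fun l => p.1.1 (Sum.inl l) = 0
  have hmemI : ∀ l, l ∈ I ↔ p.1.1 (Sum.inl l) = 0 := by simp [I]
  have hI : t.B.IsIndep I := fun i hi l hl =>
    hac.eq_zero_of_solution ht.isExchange p ((hmemI i).1 hi) ((hmemI l).1 hl)
  obtain ⟨θ, h1, h2⟩ := exists_algHom_mvPolynomial hs hst p hmemI hI
  let g : s.points K := (MvPolynomial.aeval p.1.2).comp θ
  have hgx : ∀ i, g ⟨t.x i, hst.x_mem_clusterAlgebra i⟩ = p.1.1 i := by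
    intro i
    change MvPolynomial.aeval p.1.2 (θ _) = _
    by_cases hi : ∃ l ∈ I, i = Sum.inl l
    · obtain ⟨l, hl, rfl⟩ := hi
      rw [(h2 l hl).1, map_zero, (hmemI l).1 hl]
    · push Not at hi
      rw [h1 i hi]
      simp
  have hgx' : ∀ l, g ⟨t.x' l, hst.x'_mem_clusterAlgebra l⟩ = p.1.2 l := by
    intro l
    by_cases hl : l ∈ I
    · change MvPolynomial.aeval p.1.2 (θ _) = _
      rw [(h2 l hl).2]
      simp
    · have h3 : g ⟨t.x (Sum.inl l), hst.x_mem_clusterAlgebra _⟩ *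
          g ⟨t.x' l, hst.x'_mem_clusterAlgebra l⟩ =
            t.B.exchange (fun i => g ⟨t.x i, hst.x_mem_clusterAlgebra i⟩) l :=
        (pointToSolution hs hst g).2.2 l
      simp only [hgx] at h3
      rw [← p.2.2 l] at h3
      exact mul_left_cancel₀ (fun h => hl ((hmemI l).2 h)) h3
  exact ⟨g, Subtype.ext (Prod.ext (funext hgx) (funext hgx'))⟩

theorem card_points (hs : s.IsRegular K) (hst : s.Reaches t) (hac : t.B.IsAcyclic) :
    Nat.card (s.points K) = Nat.card (t.B.Solution K) :=
  Nat.card_congr (Equiv.ofBijective _ ⟨pointToSolution_injective hs hst hac,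
    pointToSolution_surjective hs hst hac⟩)

end SeedData

end ClusterVariety

/-! ### The lattice of an independent set and characters of the torus -/

namespace ClusterVariety

namespace ExtMatrix

variable {n m : ℕ} {B : ExtMatrix n m} {I : Finset (Fin n)}

/-- The column lattice as a `ℤ`-submodule. -/
def colModule (B : ExtMatrix n m) (I : Finset (Fin n)) : Submodule ℤ (Fin n ⊕ Fin m → ℤ) :=
  LinearMap.range (B.cols I).mulVecLin

theorem mem_colLattice_iff {v : Fin n ⊕ Fin m → ℤ} : v ∈ B.colLattice I ↔ v ∈ B.colModule I :=
  Iff.rfl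

theorem mem_satLattice_iff {v : Fin n ⊕ Fin m → ℤ} : v ∈ B.satLattice I ↔
    ∃ w : I → ℚ, ((B.cols I).map (Int.cast : ℤ → ℚ)).mulVec w = fun i => (v i : ℚ) := Iff.rfl

/-- The saturated lattice consists of the vectors having a nonzero multiple in the column
lattice. -/
theorem mem_satLattice_iff_exists_smul {v : Fin n ⊕ Fin m → ℤ} :
    v ∈ B.satLattice I ↔ ∃ d : ℤ, d ≠ 0 ∧ d • v ∈ B.colModule I := by
  constructor
  · intro hv
    rw [mem_satLattice_iff] at hv
    obtain ⟨w, hw⟩ := hv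
    obtain ⟨d, hd⟩ := IsLocalization.exist_integer_multiples_of_finite (nonZeroDivisors ℤ) w
    choose u hu using hd
    refine ⟨d, nonZeroDivisors.coe_ne_zero d, u, ?_⟩
    funext i
    have h1 := congrFun hw i
    simp only [Matrix.mulVec, dotProduct, Matrix.map_apply] at h1
    have h2 : ((∑ l, B.cols I i l * u l : ℤ) : ℚ) = ((d : ℤ) * v i : ℤ) := by
      push_cast
      rw [← h1, Finset.mul_sum]
      refine Finset.sum_congr rfl fun l _ => ?_
      have h3 : (u l : ℚ) = (d : ℤ) • w l := hu l
      rw [h3, zsmul_eq_mul]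
      ring
    exact_mod_cast h2
  · rintro ⟨d, hd, w, hw⟩
    rw [mem_satLattice_iff]
    refine ⟨fun l => (w l : ℚ) / d, ?_⟩
    funext i
    have h1 := congrFun hw i
    simp only [Matrix.mulVecLin_apply, Matrix.mulVec, dotProduct, Pi.smul_apply,
      smul_eq_mul] at h1
    have h2 := congrArg (Int.cast : ℤ → ℚ) h1
    push_cast at h2
    have hd' : (d : ℚ) ≠ 0 := by exact_mod_cast hd
    simp only [Matrix.mulVec, dotProduct, Matrix.map_apply, ← mul_div_assoc]
    rw [← Finset.sum_div, h2, mul_div_cancel_left₀ _ hd']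

section Smith

variable {r : ℕ} (snf : Module.Basis.SmithNormalForm (B.colModule I) (Fin n ⊕ Fin m) r)

include snf in
theorem snf_a_ne_zero (i : Fin r) : snf.a i ≠ 0 := by
  intro h
  have h1 := snf.snf i
  rw [h, zero_smul] at h1
  exact snf.bN.ne_zero i (Subtype.ext h1)

include snf in
theorem mem_colModule_iff_repr {v : Fin n ⊕ Fin m → ℤ} : v ∈ B.colModule I ↔
    (∀ j ∉ Set.range snf.f, snf.bM.repr v j = 0) ∧ ∀ i, snf.a i ∣ snf.bM.repr v (snf.f i) := by
  constructor
  · intro hv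
    refine ⟨fun j hj => snf.repr_eq_zero_of_notMem_range ⟨v, hv⟩ hj, fun i => ?_⟩
    have h := snf.repr_apply_embedding_eq_repr_smul ⟨v, hv⟩ (i := i)
    rw [map_smul, Finsupp.smul_apply, smul_eq_mul] at h
    exact ⟨_, h⟩
  · rintro ⟨h1, h2⟩
    choose c hc using h2
    have h3 : v = ∑ i, c i • (snf.bN i : Fin n ⊕ Fin m → ℤ) := by
      classical
      rw [← snf.bM.sum_repr v, ← Finset.sum_subset (Finset.subset_univ (Finset.univ.map snf.f))]
      · rw [Finset.sum_map]
        refine Finset.sum_congr rfl fun i _ => ?_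
        rw [hc, snf.snf, smul_smul, mul_comm]
      · intro j _ hj
        rw [h1 j, zero_smul]
        rintro ⟨i, rfl⟩
        exact hj (Finset.mem_map_of_mem _ (Finset.mem_univ i))
    rw [h3]
    exact Submodule.sum_mem _ fun i _ => Submodule.smul_mem _ _ (snf.bN i).2

include snf in
theorem mem_satLattice_iff_repr {v : Fin n ⊕ Fin m → ℤ} : v ∈ B.satLattice I ↔
    ∀ j ∉ Set.range snf.f, snf.bM.repr v j = 0 := by
  rw [mem_satLattice_iff_exists_smul]
  constructor
  · rintro ⟨d, hd, h⟩ j hj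
    have := ((mem_colModule_iff_repr snf).1 h).1 j hj
    rw [map_smul, Finsupp.smul_apply, smul_eq_mul] at this
    exact (mul_eq_zero.1 this).resolve_left hd
  · intro h
    refine ⟨∏ i, snf.a i, Finset.prod_ne_zero_iff.2 fun i _ => snf_a_ne_zero snf i, ?_⟩
    rw [mem_colModule_iff_repr snf]
    refine ⟨fun j hj => ?_, fun i => ?_⟩
    · rw [map_smul, Finsupp.smul_apply, h j hj, smul_zero]
    · rw [map_smul, Finsupp.smul_apply, smul_eq_mul]
      exact Dvd.dvd.mul_right (Finset.dvd_prod_of_mem _ (Finset.mem_univ i)) _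

include snf in
theorem repr_bM_mem_satLattice (i : Fin r) : snf.bM (snf.f i) ∈ B.satLattice I := by
  rw [mem_satLattice_iff_repr snf]
  intro j hj
  rw [Module.Basis.repr_self, Finsupp.single_apply, if_neg]
  rintro rfl
  exact hj ⟨i, rfl⟩

include snf in
theorem snf_a_dvd {N : ℕ} (hN : ∀ g : B.charGroup I, N • g = 0) (i : Fin r) :
    snf.a i ∣ N := by
  have h := hN (QuotientAddGroup.mk ⟨_, repr_bM_mem_satLattice snf i⟩)
  rw [← QuotientAddGroup.mk_nsmul, QuotientAddGroup.eq_zero_iff, AddSubgroup.mem_addSubgroupOf] at h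
  have h1 := ((mem_colModule_iff_repr snf).1 (mem_colLattice_iff.1 h)).2 i
  have h2 : ((N • (⟨_, repr_bM_mem_satLattice snf i⟩ : B.satLattice I) : B.satLattice I) :
      Fin n ⊕ Fin m → ℤ) = (N : ℤ) • snf.bM (snf.f i) := (natCast_zsmul _ _).symm
  rw [h2, map_smul, Finsupp.smul_apply, Module.Basis.repr_self, Finsupp.single_eq_same, smul_eq_mul,
    mul_one] at h1
  exact h1

include snf in
theorem card_charGroup : Nat.card (B.charGroup I) = ∏ i, (snf.a i).natAbs := by
  let θ : B.satLattice I →+ ∀ i, ZMod (snf.a i).natAbs :=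
    { toFun := fun v i => (snf.bM.repr (v : Fin n ⊕ Fin m → ℤ) (snf.f i) : ZMod _)
      map_zero' := by funext i; simp
      map_add' := fun v w => by funext i; simp }
  have hker : θ.ker = (B.colLattice I).addSubgroupOf (B.satLattice I) := by
    ext v
    rw [AddMonoidHom.mem_ker, AddSubgroup.mem_addSubgroupOf, mem_colLattice_iff,
      mem_colModule_iff_repr snf, and_iff_right ((mem_satLattice_iff_repr snf).1 v.2), funext_iff]
    refine forall_congr' fun i => ?_
    change ((snf.bM.repr (v : Fin n ⊕ Fin m → ℤ) (snf.f i) : ℤ) : ZMod (snf.a i).natAbs) = 0 ↔ _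
    rw [ZMod.intCast_zmod_eq_zero_iff_dvd, Int.natCast_natAbs, abs_dvd]
  have hsurj : Function.Surjective θ := by
    intro z
    choose c hc using fun i => ZMod.intCast_surjective (z i)
    refine ⟨⟨∑ i, c i • snf.bM (snf.f i), sum_mem fun i _ =>
      zsmul_mem (repr_bM_mem_satLattice snf i) _⟩, ?_⟩
    funext i
    change ((snf.bM.repr (∑ i, c i • snf.bM (snf.f i)) (snf.f i) : ℤ) : ZMod _) = z i
    rw [← hc i]
    congr 1
    rw [map_sum, Finsupp.finsetSum_apply, Finset.sum_eq_single i]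
    · rw [map_smul, Finsupp.smul_apply, Module.Basis.repr_self, Finsupp.single_eq_same, smul_eq_mul,
        mul_one]
    · intro j _ hj
      rw [map_smul, Finsupp.smul_apply, Module.Basis.repr_self, Finsupp.single_eq_of_ne', smul_zero]
      exact fun h => hj (snf.f.injective h)
    · exact fun h => absurd (Finset.mem_univ i) h
  unfold charGroup
  rw [← hker, Nat.card_congr (QuotientAddGroup.quotientKerEquivOfSurjective θ hsurj).toEquiv,
    Nat.card_pi]
  refine Finset.prod_congr rfl fun i => ?_
  simp

end Smith

/-- In a finite cyclic group, the equation `a • g = c` has `|a|` solutions if it has one and if `a`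
divides the order. -/
theorem card_zsmul_eq {G : Type*} [AddCommGroup G] [Finite G] [IsAddCyclic G] {a : ℤ}
    (ha : a.natAbs ∣ Nat.card G) {g₀ c : G} (h₀ : a • g₀ = c) :
    Nat.card {g : G // a • g = c} = a.natAbs := by
  have h1 : Nat.card (nsmulAddMonoidHom (α := G) a.natAbs).ker = a.natAbs := by
    rw [IsAddCyclic.card_nsmulAddMonoidHom_ker, Nat.gcd_eq_right ha]
  rw [← h1]
  have h2 : ∀ g : G, a • g = 0 ↔ a.natAbs • g = 0 := by
    intro g
    rcases Int.natAbs_eq a with h | h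
    · conv_lhs => rw [h, natCast_zsmul]
    · conv_lhs => rw [h, neg_smul, natCast_zsmul, neg_eq_zero]
  refine Nat.card_congr ⟨fun g => ⟨g - g₀, ?_⟩, fun g => ⟨g + g₀, ?_⟩, fun g => by simp,
    fun g => by simp⟩
  · rw [AddMonoidHom.mem_ker]
    refine (h2 _).1 ?_
    rw [smul_sub, g.2, h₀, sub_self]
  · rw [smul_add, (h2 _).2 g.2, h₀, zero_add]

/-- The number of characters of `ℤ^(n+m)` with values in a finite cyclic group `G` sending each
column indexed by `I` to `ε`, when `ε` is sufficiently divisible. -/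
theorem card_characters {G : Type*} [AddCommGroup G] [Finite G] [IsAddCyclic G]
    (hinj : Function.Injective (B.cols I).mulVecLin) {N : ℕ} (hN : ∀ g : B.charGroup I, N • g = 0)
    {ε : G} (hdvd : N ∣ Nat.card G) (hε : ∀ a : ℕ, a ∣ N → ∃ g : G, a • g = ε) :
    Nat.card {h : Fin n ⊕ Fin m → G // ∀ l : I, ∑ i, B i l • h i = ε} =
      Nat.card G ^ (n + m - I.card) * Nat.card (B.charGroup I) := by
  classical
  obtain ⟨r, snf⟩ := Submodule.smithNormalForm (Pi.basisFun ℤ (Fin n ⊕ Fin m)) (B.colModule I)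
  let e : (I → ℤ) ≃ₗ[ℤ] B.colModule I := LinearEquiv.ofInjective _ hinj
  have hr : r = I.card := by
    have h1 := Module.finrank_eq_card_basis snf.bN
    have h2 := e.finrank_eq
    rw [h1] at h2
    simpa using h2.symm
  -- the character of the column lattice that is to be extended
  let χ : B.colModule I →ₗ[ℤ] G :=
    ((Pi.basisFun ℤ I).constr ℤ fun _ => ε) ∘ₗ e.symm.toLinearMap
  have hχ : ∀ l, χ (e (Pi.single l 1)) = ε := by
    intro l
    simp only [χ, LinearMap.comp_apply, LinearEquiv.coe_coe, LinearEquiv.symm_apply_apply]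
    rw [← Pi.basisFun_apply, Module.Basis.constr_basis]
  have hcol : ∀ (l : I) (ψ : (Fin n ⊕ Fin m → ℤ) →ₗ[ℤ] G),
      ψ (e (Pi.single l 1)) = ∑ i, B i l • ψ (Pi.single i 1) := by
    intro l ψ
    have h1 : ((e (Pi.single l 1) : B.colModule I) : Fin n ⊕ Fin m → ℤ) =
        ∑ i, B i l • Pi.single i 1 := by
      change (B.cols I).mulVec (Pi.single l 1) = _
      funext i
      simp [cols, Finset.sum_apply, Pi.single_apply]
    rw [h1, map_sum]
    exact Finset.sum_congr rfl fun i _ => map_smul ψ _ _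
  have hext : ∀ ψ : (Fin n ⊕ Fin m → ℤ) →ₗ[ℤ] G,
      (∀ l : I, ∑ i, B i l • ψ (Pi.single i 1) = ε) ↔
        ∀ i, snf.a i • ψ (snf.bM (snf.f i)) = χ (snf.bN i) := by
    intro ψ
    have h1 : (∀ l : I, ∑ i, B i l • ψ (Pi.single i 1) = ε) ↔
        ψ ∘ₗ (B.colModule I).subtype = χ := by
      constructor
      · intro h
        have h2 : (ψ ∘ₗ (B.colModule I).subtype) ∘ₗ e.toLinearMap = χ ∘ₗ e.toLinearMap := by
          refine (Pi.basisFun ℤ I).ext fun l => ?_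
          rw [Pi.basisFun_apply]
          change ψ (e (Pi.single l 1)) = χ (e (Pi.single l 1))
          rw [hχ, hcol, h]
        refine LinearMap.ext fun v => ?_
        obtain ⟨w, rfl⟩ := e.surjective v
        exact LinearMap.congr_fun h2 w
      · intro h l
        rw [← hcol, ← hχ l]
        exact LinearMap.congr_fun h (e (Pi.single l 1))
    rw [h1]
    constructor
    · intro h i
      rw [← map_smul, ← snf.snf, ← h]
      rfl
    · intro h
      refine snf.bN.ext fun i => ?_
      rw [← h i, ← map_smul, ← snf.snf]
      rfl
  have hcard1 : Nat.card {h : Fin n ⊕ Fin m → G // ∀ l : I, ∑ i, B i l • h i = ε} =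
      Nat.card {h : Fin n ⊕ Fin m → G // ∀ i, snf.a i • h (snf.f i) = χ (snf.bN i)} := by
    refine Nat.card_congr ((((Pi.basisFun ℤ (Fin n ⊕ Fin m)).constr ℤ).toEquiv.trans
      (snf.bM.constr ℤ).symm.toEquiv).subtypeEquiv fun h => ?_)
    have h1 := hext ((Pi.basisFun ℤ (Fin n ⊕ Fin m)).constr ℤ h)
    have h2 : ∀ i, (Pi.basisFun ℤ (Fin n ⊕ Fin m)).constr ℤ h (Pi.single i 1) = h i := by
      intro i
      rw [← Pi.basisFun_apply, Module.Basis.constr_basis]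
    simp only [h2] at h1
    rw [h1]
    rfl
  let S : Fin n ⊕ Fin m → Type _ := fun j =>
    {g : G // ∀ i, snf.f i = j → snf.a i • g = χ (snf.bN i)}
  have hcard2 : Nat.card {h : Fin n ⊕ Fin m → G // ∀ i, snf.a i • h (snf.f i) = χ (snf.bN i)} =
      ∏ j, Nat.card (S j) := by
    rw [← Nat.card_pi]
    exact Nat.card_congr ⟨fun h j => ⟨h.1 j, by rintro i rfl; exact h.2 i⟩,
      fun h => ⟨fun j => (h j).1, fun i => (h (snf.f i)).2 i rfl⟩, fun h => rfl, fun h => rfl⟩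
  have hS1 : ∀ i, Nat.card (S (snf.f i)) = (snf.a i).natAbs := by
    intro i
    have hai : (snf.a i).natAbs ∣ N := by
      have := snf_a_dvd snf hN i
      rwa [← Int.natAbs_dvd_natAbs, Int.natAbs_natCast] at this
    obtain ⟨g, hg⟩ := hε _ hai
    obtain ⟨g₀, hg₀⟩ : ∃ g₀ : G, snf.a i • g₀ = ε := by
      rcases Int.natAbs_eq (snf.a i) with h | h
      · exact ⟨g, by rw [h, natCast_zsmul, hg]⟩
      · exact ⟨-g, by rw [h, neg_smul, smul_neg, neg_neg, natCast_zsmul, hg]⟩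
    have hmul : ∃ c : ℤ, χ (snf.bN i) = c • ε := by
      refine ⟨∑ l, e.symm (snf.bN i) l, ?_⟩
      simp only [χ, LinearMap.comp_apply, LinearEquiv.coe_coe, Module.Basis.constr_apply_fintype,
        Finset.sum_smul]
      rfl
    obtain ⟨c, hc⟩ := hmul
    rw [← card_zsmul_eq (hai.trans hdvd) (g₀ := c • g₀) (c := χ (snf.bN i))
      (by rw [smul_comm, hg₀, hc])]
    refine Nat.card_congr (Equiv.subtypeEquivRight fun g => ⟨fun h => h i rfl, fun h j hj => ?_⟩)
    obtain rfl := snf.f.injective hj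
    exact h
  have hS2 : ∀ j ∉ Finset.univ.map snf.f, Nat.card (S j) = Nat.card G := by
    intro j hj
    refine Nat.card_congr (Equiv.subtypeUnivEquiv fun g i hi => ?_)
    subst hi
    exact absurd (Finset.mem_map_of_mem _ (Finset.mem_univ i)) hj
  rw [hcard1, hcard2, ← Finset.prod_mul_prod_compl (Finset.univ.map snf.f), Finset.prod_map,
    Finset.prod_congr rfl fun i _ => hS1 i, ← card_charGroup snf,
    Finset.prod_congr rfl fun j hj => hS2 j (Finset.mem_compl.1 hj), Finset.prod_const,
    Finset.card_compl, Finset.card_map, mul_comm]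
  simp [hr]

end ExtMatrix

end ClusterVariety

/-! ### Counting solutions of the exchange relations -/

namespace ClusterVariety

namespace ExtMatrix

variable {n m : ℕ} {B : ExtMatrix n m} {I : Finset (Fin n)}

theorem ColInjective.cols (hB : B.ColInjective) (I : Finset (Fin n)) :
    Function.Injective (B.cols I).mulVecLin := by
  classical
  rw [injective_iff_map_eq_zero]
  intro w hw
  have h := hB (fun j => if h : j ∈ I then w ⟨j, h⟩ else 0) (by
    funext i
    rw [← hw]
    simp only [Matrix.mulVec, dotProduct, Matrix.mulVecLin_apply, ExtMatrix.cols,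
      Matrix.submatrix_apply, id]
    rw [← Finset.sum_subset (Finset.subset_univ I), ← Finset.sum_coe_sort I]
    · refine Finset.sum_congr rfl fun l _ => ?_
      rw [dif_pos l.2]
    · intro j _ hj
      rw [dif_neg hj, mul_zero])
  funext l
  simpa using congrFun h l

/-- The columns indexed by an independent set `I` vanish in the rows indexed by `I`, so that their
linear independence bounds `#I` by the number of the remaining rows. -/
theorem IsIndep.two_mul_card_le (hI : B.IsIndep I) (hB : B.ColInjective) :
    2 * I.card ≤ n + m := by
  classical
  let J : Finset (Fin n ⊕ Fin m) := (I.map Function.Embedding.inl)ᶜ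
  let f : (I → ℤ) →ₗ[ℤ] (J → ℤ) := ((B.cols I).submatrix (Subtype.val : J → _) id).mulVecLin
  have hf : Function.Injective f := by
    rw [injective_iff_map_eq_zero]
    intro w hw
    refine (injective_iff_map_eq_zero _).1 (hB.cols I) w (funext fun i => ?_)
    by_cases hi : i ∈ J
    · exact congrFun hw ⟨i, hi⟩
    · simp only [J, Finset.mem_compl, not_not, Finset.mem_map, Function.Embedding.inl_apply] at hi
      obtain ⟨j, hj, rfl⟩ := hi
      exact Finset.sum_eq_zero fun l _ => mul_eq_zero_of_left (hI j hj l l.2) _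
  have h := LinearMap.finrank_le_finrank_of_injective hf
  simp only [Module.finrank_fintype_fun_eq_card, Fintype.card_coe, J, Finset.card_compl,
    Finset.card_map, Fintype.card_sum, Fintype.card_fin] at h
  have h2 : I.card ≤ n := by simpa using I.card_le_univ
  omega

variable {K : Type*} [Field K]

theorem exchange_units_eq_zero_iff (B : ExtMatrix n m) (χ : Fin n ⊕ Fin m → Kˣ) (l : Fin n) :
    B.exchange (fun i => (χ i : K)) l = 0 ↔ ∏ i, χ i ^ B i l = -1 := by
  have h1 : ∏ i, χ i ^ (B i l).toNat = (∏ i, χ i ^ B i l) * ∏ i, χ i ^ (-B i l).toNat := by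
    rw [← Finset.prod_mul_distrib]
    refine Finset.prod_congr rfl fun i _ => ?_
    rw [← zpow_natCast, ← zpow_natCast, ← zpow_add]
    congr 1
    omega
  have h2 : B.exchange (fun i => (χ i : K)) l =
      (((∏ i, χ i ^ B i l : Kˣ) : K) + 1) * ((∏ i, χ i ^ (-B i l).toNat : Kˣ) : K) := by
    rw [add_mul, one_mul, ← Units.val_mul, ← h1]
    simp [exchange]
  rw [h2, mul_eq_zero, or_iff_left (Units.ne_zero _), ← Units.val_inj, Units.val_neg, Units.val_one,
    eq_neg_iff_add_eq_zero]

variable (B I K) in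
/-- The solutions of the exchange relations for which the vanishing mutable variables are those
indexed by `I`. -/
abbrev Stratum : Type _ := {p : B.Solution K // ∀ l, p.1.1 (Sum.inl l) = 0 ↔ l ∈ I}

variable (B I K) in
/-- The points of the torus at which the exchange binomials indexed by `I` vanish. -/
abbrev TorusFibre : Type _ := {χ : Fin n ⊕ Fin m → Kˣ // ∀ l : I, ∏ i, χ i ^ B i l = -1}

section Extend

open Classical in
/-- The point obtained from a point of the torus by setting the variables indexed by `I` to zero. -/
noncomputable def killVars (I : Finset (Fin n)) (χ : Fin n ⊕ Fin m → Kˣ) : Fin n ⊕ Fin m → K :=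
  Sum.elim (fun l => if l ∈ I then 0 else (χ (Sum.inl l) : K)) fun j => χ (Sum.inr j)

theorem killVars_inl_eq_zero (χ : Fin n ⊕ Fin m → Kˣ) (l : Fin n) :
    killVars I χ (Sum.inl l) = 0 ↔ l ∈ I := by
  by_cases h : l ∈ I <;> simp [killVars, h]

theorem killVars_apply (χ : Fin n ⊕ Fin m → Kˣ) {i : Fin n ⊕ Fin m}
    (hi : ∀ l ∈ I, i ≠ Sum.inl l) : killVars I χ i = χ i := by
  rcases i with l | j
  · have : l ∉ I := fun h => hi l h rfl
    simp [killVars, this]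
  · rfl

/-- Since `I` is independent, the exchange binomials indexed by `I` do not involve the variables
indexed by `I`. -/
theorem IsIndep.exchange_killVars (hI : B.IsIndep I) (χ : Fin n ⊕ Fin m → Kˣ) {l : Fin n}
    (hl : l ∈ I) : B.exchange (killVars I χ) l = B.exchange (fun i => (χ i : K)) l :=
  exchange_congr (fun _ => rfl) fun i hi => killVars_apply χ fun j hj hij => by
    subst hij
    exact hi (hI j hj l hl)

open Classical in
/-- The point of a stratum determined by a point of the torus and by the values of the variables
`x' l` for `l ∈ I`, which are free on the stratum. -/
noncomputable def IsIndep.toStratum (hI : B.IsIndep I) (p : TorusFibre B I K × (I → K)) :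
    Stratum B I K :=
  ⟨⟨(killVars I p.1.1, fun l => if h : l ∈ I then p.2 ⟨l, h⟩ else
      B.exchange (killVars I p.1.1) l / killVars I p.1.1 (Sum.inl l)),
    fun j => (p.1.1 (Sum.inr j)).ne_zero, fun l => by
      by_cases h : l ∈ I
      · have h1 := (exchange_units_eq_zero_iff B p.1.1 l).2 (p.1.2 ⟨l, h⟩)
        rw [hI.exchange_killVars _ h, h1]
        exact mul_eq_zero_of_left ((killVars_inl_eq_zero _ l).2 h) _
      · dsimp only
        rw [dif_neg h, mul_div_cancel₀]
        rwa [Ne, killVars_inl_eq_zero]⟩,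
    fun l => killVars_inl_eq_zero _ l⟩

/-- A point of the torus fibre and the free values `x' l` amount to a point of the stratum and the
coordinates of the torus point indexed by `I`, on which the point of the stratum does not depend. -/
theorem IsIndep.toStratum_bijective (hI : B.IsIndep I) : Function.Bijective
    fun p : TorusFibre B I K × (I → K) =>
      (hI.toStratum p, fun l : I => p.1.1 (Sum.inl l.1)) := by
  classical
  constructor
  · intro p p' h
    rw [Prod.ext_iff] at h
    obtain ⟨h1, h2⟩ := h
    have ha : killVars I p.1.1 = killVars I p'.1.1 :=
      congrArg (fun r : Stratum B I K => r.1.1.1) h1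
    have hb := congrArg (fun r : Stratum B I K => r.1.1.2) h1
    refine Prod.ext (Subtype.ext (funext fun i => ?_)) (funext fun l => ?_)
    · by_cases hi : ∃ l ∈ I, i = Sum.inl l
      · obtain ⟨l, hl, rfl⟩ := hi
        exact congrFun h2 ⟨l, hl⟩
      · push Not at hi
        have := congrFun ha i
        rw [killVars_apply _ hi, killVars_apply _ hi] at this
        exact Units.ext this
    · simpa [IsIndep.toStratum, l.2] using congrFun hb l.1
  · rintro ⟨p, d⟩
    let χ : Fin n ⊕ Fin m → Kˣ := Sum.elim
      (fun l => if h : l ∈ I then d ⟨l, h⟩ else Units.mk0 _ (mt (p.2 l).1 h))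
      fun j => Units.mk0 _ (p.1.2.1 j)
    have hχ : killVars I χ = p.1.1.1 := by
      funext i
      rcases i with l | j
      · by_cases h : l ∈ I
        · rw [(killVars_inl_eq_zero χ l).2 h, (p.2 l).2 h]
        · simp [killVars, χ, h]
      · rfl
    have hχI : ∀ l : I, ∏ i, χ i ^ B i l = -1 := by
      intro l
      rw [← exchange_units_eq_zero_iff, ← hI.exchange_killVars χ l.2, hχ, ← p.1.2.2 l,
        (p.2 l).2 l.2, zero_mul]
    refine ⟨(⟨χ, hχI⟩, fun l => p.1.1.2 l),
      Prod.ext (Subtype.ext (Subtype.ext (Prod.ext hχ ?_))) ?_⟩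
    · funext l
      by_cases h : l ∈ I
      · simp [IsIndep.toStratum, h]
      · have h0 : p.1.1.1 (Sum.inl l) ≠ 0 := mt (p.2 l).1 h
        simp only [IsIndep.toStratum, hχ, dif_neg h]
        rw [div_eq_iff h0, ← p.1.2.2 l, mul_comm]
    · funext l
      simp [χ]

end Extend

variable [Finite K]

/-- If `2 * N` divides the order of the multiplicative group of a finite field, then `-1` has
`a`-th roots for all `a` dividing `N`. -/
theorem exists_pow_eq_neg_one {N a : ℕ} (hN : 2 * N ∣ Nat.card Kˣ) (ha : a ∣ N) :
    ∃ u : Kˣ, u ^ a = -1 := by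
  obtain ⟨g, hg⟩ := IsCyclic.exists_generator (α := Kˣ)
  have ho : orderOf g = Nat.card Kˣ := orderOf_eq_card_of_forall_mem_zpowers hg
  obtain ⟨b, rfl⟩ := ha
  obtain ⟨c, hc⟩ := hN
  refine ⟨g ^ (b * c), ?_⟩
  have hpos : 0 < Nat.card Kˣ := Nat.card_pos
  rw [← pow_mul]
  have h1 : g ^ (b * c * a) ≠ 1 := by
    intro h
    have h2 := orderOf_dvd_of_pow_eq_one h
    rw [ho, hc] at h2
    rw [hc] at hpos
    have h3 : 0 < b * c * a := by
      rw [show 2 * (a * b) * c = 2 * (b * c * a) by ring] at hpos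
      omega
    have := Nat.le_of_dvd h3 h2
    rw [show 2 * (a * b) * c = 2 * (b * c * a) by ring] at this
    omega
  have h2 : (g ^ (b * c * a)) ^ 2 = 1 := by
    rw [← pow_mul, ← pow_card_eq_one' (x := g), hc]
    congr 1
    ring
  have h3 : ((g ^ (b * c * a) : Kˣ) : K) ^ 2 = 1 := by
    rw [← Units.val_pow_eq_pow_val, h2, Units.val_one]
  rcases mul_self_eq_one_iff.1 ((sq _).symm.trans h3) with h | h
  · exact absurd (Units.ext h) h1
  · exact Units.ext h

/-- The torus fibre consists of the characters taking the value `-1` on the columns indexed by `I`. -/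
theorem card_torusFibre (hB : B.ColInjective) {N : ℕ} (hN : ∀ g : B.charGroup I, N • g = 0)
    (hdvd : 2 * N ∣ Nat.card Kˣ) : Nat.card (TorusFibre B I K) =
      Nat.card Kˣ ^ (n + m - I.card) * Nat.card (B.charGroup I) :=
  card_characters (G := Additive Kˣ) (hB.cols I) hN (ε := Additive.ofMul (-1))
    ((Dvd.intro_left 2 rfl).trans hdvd) fun _ ha => exists_pow_eq_neg_one hdvd ha

theorem card_stratum (hI : B.IsIndep I) (hB : B.ColInjective) {N : ℕ}
    (hN : ∀ g : B.charGroup I, N • g = 0) (hdvd : 2 * N ∣ Nat.card Kˣ) :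
    Nat.card (Stratum B I K) = Nat.card K ^ I.card * Nat.card Kˣ ^ (n + m - 2 * I.card) *
      Nat.card (B.charGroup I) := by
  have h := Nat.card_congr (Equiv.ofBijective _ (hI.toStratum_bijective (K := K)))
  rw [Nat.card_prod, Nat.card_prod, card_torusFibre hB hN hdvd, Nat.card_fun, Nat.card_fun,
    Nat.card_eq_fintype_card (α := I), Fintype.card_coe] at h
  have h2 := hI.two_mul_card_le hB
  have hpos : 0 < Nat.card Kˣ ^ I.card := pow_pos Nat.card_pos _
  refine Nat.eq_of_mul_eq_mul_right hpos ?_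
  rw [← h, show n + m - I.card = n + m - 2 * I.card + I.card by omega, pow_add]
  ring

theorem card_solution (hB : B.ColInjective) (hex : B.IsExchange) (hac : B.IsAcyclic) {N : ℕ}
    (hN : ∀ k, ∀ I ∈ B.anticliques k, ∀ g : B.charGroup I, N • g = 0)
    (hdvd : 2 * N ∣ Nat.card Kˣ) : Nat.card (B.Solution K) =
      ∑ k ∈ Finset.range (n + 1), Nat.card K ^ k * Nat.card Kˣ ^ (n + m - 2 * k) *
        ∑ I ∈ B.anticliques k, Nat.card (B.charGroup I) := by
  classical
  let Z : B.Solution K → Finset (Fin n) := fun p =>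
    Finset.univ.filter fun l => p.1.1 (Sum.inl l) = 0
  have hZ : ∀ p, B.IsIndep (Z p) := fun p i hi l hl =>
    hac.eq_zero_of_solution hex p (Finset.mem_filter.1 hi).2 (Finset.mem_filter.1 hl).2
  have hfib : ∀ I, Nat.card {p // Z p = I} = Nat.card (Stratum B I K) := fun I =>
    Nat.card_congr (Equiv.subtypeEquivRight fun p => by simp [Z, Finset.ext_iff])
  rw [← Nat.card_congr (Equiv.sigmaFiberEquiv Z), Nat.card_sigma,
    ← Finset.sum_fiberwise_of_maps_to (s := Finset.univ) (t := Finset.range (n + 1))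
      (g := Finset.card) fun I _ => Finset.mem_range.2
        (Nat.lt_succ_of_le (by simpa using I.card_le_univ))]
  refine Finset.sum_congr rfl fun k _ => ?_
  rw [Finset.mul_sum]
  symm
  refine Finset.sum_subset_zero_on_sdiff (fun I hI => ?_) (fun I hI => ?_) fun I hI => ?_
  · simpa using ((mem_anticliques hex).1 hI).1
  · rw [Finset.mem_sdiff, Finset.mem_filter, mem_anticliques hex] at hI
    have : IsEmpty {p // Z p = I} := ⟨fun p => hI.2 ⟨hI.1.2, p.2 ▸ hZ p.1⟩⟩
    exact Nat.card_of_isEmpty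
  · obtain ⟨rfl, hI'⟩ := (mem_anticliques hex).1 hI
    rw [hfib, card_stratum hI' hB (hN _ I hI) hdvd]

end ExtMatrix

end ClusterVariety

theorem mainTheorem10 {K 𝓕 : Type*} [Field K] [Finite K] [Field 𝓕] [Algebra K 𝓕] {n m : ℕ}
    (s t : ClusterVariety.SeedData 𝓕 n m) (hs : s.IsSeed K) (hrank : s.B.FullRank)
    (hst : s.Reaches t) (hacyclic : t.B.IsAcyclic)
    (N : ℕ)
    (hN : IsLeast {M : ℕ | 0 < M ∧ ∀ k, ∀ I ∈ t.B.anticliques k,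
      ∀ g : t.B.charGroup I, M • g = 0} N)
    (q : ℕ) (hq : Nat.card K = q) (hqN : q ≡ 1 [MOD 2 * N]) :
    Nat.card (s.points K) =
      ∑ k ∈ Finset.range (n + 1), q ^ k * (q - 1) ^ (n + m - 2 * k) *
        ∑ I ∈ t.B.anticliques k, Nat.card (t.B.charGroup I) := by
  subst hq
  have hs' := hs.isRegular hrank
  have ht := hs'.reaches hst
  have hdvd : 2 * N ∣ Nat.card Kˣ := by
    rw [Nat.card_units]
    exact (Nat.modEq_iff_dvd' Nat.card_pos).1 hqN.symm
  rw [ClusterVariety.SeedData.card_points hs' hst hacyclic,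
    ClusterVariety.ExtMatrix.card_solution ht.colInjective ht.isExchange hacyclic hN.1.2 hdvd,
    Nat.card_units]
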